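/- **Graph models and their theories.** For a set $X$ let $X^*$ be the set of finite subsets of $X$. A *graph model* $\mathcal G=(G,c)$ is an infinite set $G$ with an injective total function $c:G^*\times G\to G$. $\lambda$-terms are interpreted, for environments $\rho:\mathrm{Var}\to\mathcal P(G)$, by $x_\rho=\rho(x)$, $(MN)_\rho=\{\alpha:\exists a\in G^*,\ a\subseteq N_\rho,\ c(a,\alpha)\in M_\rho\}$, $(\lambda x.M)_\rho=\{c(a,\alpha): a\in G^*,\ \alpha\in M_{\rho[x:=a]}\}$. The *order theory* of $\mathcal G$ is the set of all $M\sqsubseteq N$ with $M_\rho\subseteq N_\rho$ for all $\rho$; the *equational theory* is the set of all $M=N$ with $M_\rho=N_\rho$ for all $\rho$. An order (equational) graph theory is the order (equational) theory of some graph model; minimum means least for inclusion. **Partial pairs.** A *partial pair* is a set $A$ with a partial injective function $c_A:A^*\times A\rightharpoonup A$. Its *completion* (for $A\neq\emptyset$, the elements of $A$ being regarded as atoms) is the graph model on $E=\bigcup_n E_n$, where $E_0=A$, $E_{n+1}=E_n\cup((E_n^*\times E_n)\setminus\operatorname{dom}c_A)$, with $c_E(a,\alpha)=c_A(a,\alpha)$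 if this is defined and $c_E(a,\alpha)=(a,\alpha)$ otherwise. An *effective enumeration* of the finite partial pairs on $\mathbb N$ is a surjection $k\mapsto\mathcal N_k$ from $\mathbb N$ onto the set of all partial pairs whose carrier is a finite subset of $\mathbb N$, such that the carrier and the graph of the function of $\mathcal N_k$ are computable, as explicit finite objects, from $k$. **Effectivity.** An *effective domain* is a Scott domain $D$ with a numeration $d:\mathbb N\to K(D)$ of its set $K(D)$ of compact elements (a surjection) such that the relations "$d_m,d_n$ have an upper bound" and "$d_n=d_m\sqcup d_k$" are decidable. An element $v\in D$ is *r.e.* (*decidable*) if $\{n:d_n\sqsubseteq v\}$ is. The set $[D\to E]$ of Scott continuous functions carries the numeration of its compact elements by (codes of) finite lists of step functions, a list being sent to its supremum if it is bounded and to $\bot$ otherwise. A reflexive object $\mathcal A:D\to[D\to D]$, $\lambda:[D\to D]\to D$, $\mathcal A\circ\lambda=\mathrm{id}$ (Scott continuous maps) is *effective* if $D$ is an effective domain, $\mathcal A$ and $\lambda$ are r.e. elements of $[D\to[D\to D]]$ and $[[D\to D]\to D]$, and, writing $uv$ for $\mathcal A(u)(v)$, (i) if $k\in K(D)$ and $e_1,\dots,e_n\in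 D$ are decidable, then $ke_1\cdots e_n$ is decidable; (ii) if $f\in[D\to D]$ is r.e. and $f(e)$ is decidable uniformly in $e\in K(D)$, that is, $\{(m,n):d_m\sqsubseteq f(d_n)\}$ is decidable, then $\lambda(f)$ is decidable. A graph model $(G,c)$ is *effective* if, for some numeration of the compact elements of $\mathcal P(G)$, the reflexive object $(\mathcal P(G),\subseteq)$ with $\mathcal A(X)(Y)=\{\alpha:\exists a\in G^*,\ a\subseteq Y,\ c(a,\alpha)\in X\}$ and $\lambda(f)=\{c(a,\alpha):a\in G^*,\ \alpha\in f(a)\}$ is effective. **Theorem.** There exists a bijective effective enumeration of all finite partial pairs on $\mathbb N$. For every effective enumeration $(\mathcal N_k)_{k\in\mathbb N}$ of all finite partial pairs on $\mathbb N$, the completion of the disjoint union of the $\mathcal N_k$ is an effective graph model, its order theory is the minimum order graph theory, and its equational theory is the minimum equational graph theory. -/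

import Mathlib

universe u v

noncomputable section

namespace LambdaGraph

/-! ### Lambda terms -/

/-- Untyped lambda terms over the variables `0, 1, 2, …` (with named bound variables). -/
inductive LamTerm : Type
  | var (x : ℕ) : LamTerm
  | app (M N : LamTerm) : LamTerm
  | lam (x : ℕ) (M : LamTerm) : LamTerm

/-! ### Scott domains, effective domains, effective lambda models -/

/-- The set `[D → E]` of Scott continuous functions, with the pointwise order. -/
abbrev ScottMap (D : Type u) (E : Type v) [PartialOrder D] [PartialOrder E] : Type (max u v) :=
  {f : D → E // ScottContinuous f}

theorem scottContinuous_bot (D : Type u) (E : Type v) [PartialOrder D] [PartialOrder E]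
    [OrderBot E] : ScottContinuous (fun _ : D => (⊥ : E)) := by
  rintro s ⟨x, hx⟩ _ a _
  refine ⟨?_, fun _ _ => bot_le⟩
  rintro _ ⟨y, _, rfl⟩
  exact le_rfl

instance scottMapOrderBot (D : Type u) (E : Type v) [PartialOrder D] [PartialOrder E]
    [OrderBot E] : OrderBot (ScottMap D E) where
  bot := ⟨fun _ => ⊥, scottContinuous_bot D E⟩
  bot_le _ := fun _ => bot_le

/-- Scott domains: a partial order with a least element (the instance `OrderBot D`) in which
directed sets have suprema, which is bounded complete, and in which every element is the
supremum of the directed set of compact elements below it. -/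
structure IsScottDomain (D : Type u) [PartialOrder D] [OrderBot D] : Prop where
  directed_sup : ∀ s : Set D, s.Nonempty → DirectedOn (· ≤ ·) s → ∃ a, IsLUB s a
  bounded_sup : ∀ s : Set D, BddAbove s → ∃ a, IsLUB s a
  directed_compact : ∀ a : D, DirectedOn (· ≤ ·) {k | IsCompactElement k ∧ k ≤ a}
  algebraic : ∀ a : D, IsLUB {k | IsCompactElement k ∧ k ≤ a} a

/-- `(D, ≤, d)` is an effective domain: `D` is a Scott domain, `d` is a numeration of the compact
elements of `D`, and the relations "`d m`, `d n` have an upper bound" and "`d n = d m ⊔ d k`"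
are decidable. -/
structure IsEffectiveDomain {D : Type u} [PartialOrder D] [OrderBot D] (d : ℕ → D) : Prop where
  scott : IsScottDomain D
  range_eq : Set.range d = {k | IsCompactElement k}
  bounded_decidable : ComputablePred fun p : ℕ × ℕ => BddAbove {d p.1, d p.2}
  join_decidable : ComputablePred fun p : ℕ × ℕ × ℕ => IsLUB {d p.2.1, d p.2.2} (d p.1)

/-- `v` is an r.e. element with respect to the numeration `d` of the compact elements. -/
def IsREElement {D : Type u} [PartialOrder D] (d : ℕ → D) (v : D) : Prop :=
  REPred fun n => d n ≤ v

/-- `v` is a decidable element with respect to the numeration `d` of the compact elements. -/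
def IsDecElement {D : Type u} [PartialOrder D] (d : ℕ → D) (v : D) : Prop :=
  ComputablePred fun n => d n ≤ v

open Classical in
/-- The numeration of the compact elements of the function space `[D → E]` that is induced by
numerations `d`, `e` of the compact elements of `D`, `E`. The number `n` codes a finite list of
pairs `(i, j)`, and is sent to the supremum of the step functions `d i ↘ e j` (that is, the least
continuous `f` with `e j ≤ f (d i)`, for all `(i, j)` in the list) if these step functions are
bounded, and to `⊥` otherwise. -/
def funNum {D : Type u} {E : Type v} [PartialOrder D] [PartialOrder E] [OrderBot E]
    (d : ℕ → D) (e : ℕ → E) (n : ℕ) : ScottMap D E :=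
  if h : ∃ f : ScottMap D E,
      IsLeast {g : ScottMap D E | ∀ p ∈ Denumerable.ofNat (List (ℕ × ℕ)) n, e p.2 ≤ g.1 (d p.1)} f
  then h.choose else ⊥

/-- A reflexive object `(D, A, λ)` of Scott continuous semantics. -/
structure ReflexiveObject (D : Type u) [PartialOrder D] where
  app : ScottMap D (ScottMap D D)
  lam : ScottMap (ScottMap D D) D
  app_lam : ∀ f : ScottMap D D, app.1 (lam.1 f) = f

/-- Weakly effective models: `(D, d)` is an effective domain, and `A` and `λ` are r.e. elements of
`[D → [D → D]]` and `[[D → D] → D]`. -/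
structure IsWeaklyEffective {D : Type u} [PartialOrder D] [OrderBot D] (R : ReflexiveObject D)
    (d : ℕ → D) : Prop where
  domain : IsEffectiveDomain d
  app_re : IsREElement (funNum d (funNum d d)) R.app
  lam_re : IsREElement (funNum (funNum d d) d) R.lam

/-- Effective models. -/
structure IsEffectiveModel {D : Type u} [PartialOrder D] [OrderBot D] (R : ReflexiveObject D)
    (d : ℕ → D) : Prop extends IsWeaklyEffective R d where
  /-- If `k` is compact and `e₁, …, eₙ` are decidable, then `k e₁ … eₙ` is decidable. -/
  app_dec : ∀ k : D, IsCompactElement k → ∀ es : List D, (∀ e ∈ es, IsDecElement d e) →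
    IsDecElement d (es.foldl (fun x y => (R.app.1 x).1 y) k)
  /-- If `f` is r.e. and `f e` is decidable, uniformly in the compact element `e`, then `λ f` is
  decidable. -/
  lam_dec : ∀ f : ScottMap D D, IsREElement (funNum d d) f →
    (ComputablePred fun p : ℕ × ℕ => d p.1 ≤ f.1 (d p.2)) → IsDecElement d (R.lam.1 f)

/-! ### Graph models -/

/-- A graph model: an infinite set `G` with an injective total function `c : G* × G → G`, where
`G*` is the set of finite subsets of `G`. -/
structure GraphModel : Type (u + 1) where
  carrier : Type u
  infinite : Infinite carrier
  c : Finset carrier → carrier → carrier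
  inj : ∀ a α b β, c a α = c b β → a = b ∧ α = β

namespace GraphModel

variable (G : GraphModel.{u})

/-- The interpretation of lambda terms in a graph model. -/
def interp : LamTerm → (ℕ → Set G.carrier) → Set G.carrier
  | .var x, ρ => ρ x
  | .app M N, ρ => {α | ∃ a : Finset G.carrier, (a : Set G.carrier) ⊆ interp N ρ ∧
      G.c a α ∈ interp M ρ}
  | .lam x M, ρ => {γ | ∃ (a : Finset G.carrier) (α : G.carrier), γ = G.c a α ∧
      α ∈ interp M (Function.update ρ x (a : Set G.carrier))}

/-- The order theory: all `M ⊑ N` such that `M` is below `N` in all environments. -/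
def ordTheory : Set (LamTerm × LamTerm) :=
  {p | ∀ ρ : ℕ → Set G.carrier, G.interp p.1 ρ ⊆ G.interp p.2 ρ}

/-- The equational theory: all `M = N` such that `M` and `N` agree in all environments. -/
def eqTheory : Set (LamTerm × LamTerm) :=
  {p | ∀ ρ : ℕ → Set G.carrier, G.interp p.1 ρ = G.interp p.2 ρ}

end GraphModel

/-- The order theories of graph models (with carrier in the universe `u`). -/
def orderGraphTheories : Set (Set (LamTerm × LamTerm)) :=
  {T | ∃ G : GraphModel.{u}, G.ordTheory = T}

/-- The equational theories of graph models (with carrier in the universe `u`). -/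
def eqGraphTheories : Set (Set (LamTerm × LamTerm)) :=
  {T | ∃ G : GraphModel.{u}, G.eqTheory = T}

theorem scottContinuous_of_finitary {X : Type u} {E : Type v} {f : Set X → Set E}
    (hm : Monotone f)
    (hf : ∀ Y, ∀ β ∈ f Y, ∃ a : Finset X, (a : Set X) ⊆ Y ∧ β ∈ f (a : Set X)) :
    ScottContinuous f := by
  intro s hs hd Y hY
  refine ⟨?_, ?_⟩
  · rintro _ ⟨Z, hZ, rfl⟩
    exact hm (hY.1 hZ)
  · intro B hB β hβ
    obtain ⟨a, haY, ha⟩ := hf Y β hβ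
    have hYs : Y = ⋃₀ s := hY.unique (isLUB_sSup s)
    subst hYs
    obtain ⟨Z, hZ, haZ⟩ := DirectedOn.exists_mem_subset_of_finset_subset_biUnion (f := id)
      (s := a) hs (by simpa [DirectedOn] using hd) (by simpa [Set.sUnion_eq_biUnion] using haY)
    exact hB ⟨Z, hZ, rfl⟩ (hm haZ ha)

namespace GraphModel

variable (G : GraphModel.{u})

/-- `A(X)(Y) = {α | (∃ a ⊆ Y) c(a, α) ∈ X}`. -/
def appSet (X Y : Set G.carrier) : Set G.carrier :=
  {α | ∃ a : Finset G.carrier, (a : Set G.carrier) ⊆ Y ∧ G.c a α ∈ X}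

/-- `λ(f) = {c(a, α) | α ∈ f(a)}`. -/
def lamSet (f : Set G.carrier → Set G.carrier) : Set G.carrier :=
  {γ | ∃ (a : Finset G.carrier) (α : G.carrier), γ = G.c a α ∧ α ∈ f (a : Set G.carrier)}

theorem appSet_continuous (X : Set G.carrier) : ScottContinuous (G.appSet X) := by
  refine scottContinuous_of_finitary ?_ ?_
  · rintro Y Z hYZ α ⟨a, ha, h⟩
    exact ⟨a, ha.trans hYZ, h⟩
  · rintro Y α ⟨a, ha, h⟩
    exact ⟨a, ha, a, subset_rfl, h⟩

theorem scottMap_le_of_forall {X : Type u} {f g : ScottMap (Set X) (Set X)}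
    (h : ∀ Y, f.1 Y ⊆ g.1 Y) : f ≤ g := h

theorem appMap_continuous :
    ScottContinuous fun X : Set G.carrier =>
      (⟨G.appSet X, G.appSet_continuous X⟩ : ScottMap (Set G.carrier) (Set G.carrier)) := by
  intro s hs hd X hX
  refine ⟨?_, ?_⟩
  · rintro _ ⟨Z, hZ, rfl⟩
    refine scottMap_le_of_forall fun Y => ?_
    rintro α ⟨a, ha, h⟩
    exact ⟨a, ha, hX.1 hZ h⟩
  · intro f hf
    refine scottMap_le_of_forall fun Y => ?_
    rintro α ⟨a, ha, h⟩
    have hXs : X = ⋃₀ s := hX.unique (isLUB_sSup s)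
    subst hXs
    obtain ⟨Z, hZ, hZ'⟩ := h
    exact hf ⟨Z, hZ, rfl⟩ Y ⟨a, ha, hZ'⟩

theorem scottContinuous_union {X : Type u} (s : Set (ScottMap (Set X) (Set X))) :
    ScottContinuous fun Y : Set X => ⋃ f ∈ s, f.1 Y := by
  intro t ht hd Y hY
  refine ⟨?_, ?_⟩
  · rintro _ ⟨Z, hZ, rfl⟩ α hα
    simp only [Set.mem_iUnion] at hα ⊢
    obtain ⟨f, hf, hα⟩ := hα
    exact ⟨f, hf, f.2.monotone (hY.1 hZ) hα⟩
  · intro B hB α hα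
    simp only [Set.mem_iUnion] at hα
    obtain ⟨f, hf, hα⟩ := hα
    refine (f.2 ht hd hY).2 (fun C hC => ?_) hα
    obtain ⟨Z, hZ, rfl⟩ := hC
    intro β hβ
    refine hB ⟨Z, hZ, rfl⟩ ?_
    simp only [Set.mem_iUnion]
    exact ⟨f, hf, hβ⟩

theorem lamMap_continuous :
    ScottContinuous fun f : ScottMap (Set G.carrier) (Set G.carrier) => G.lamSet f.1 := by
  intro s hs hd f hf
  refine ⟨?_, ?_⟩
  · rintro _ ⟨g, hg, rfl⟩ γ ⟨a, α, rfl, h⟩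
    exact ⟨a, α, rfl, hf.1 hg _ h⟩
  · rintro B hB γ ⟨a, α, rfl, h⟩
    have hle : f ≤ ⟨fun Y => ⋃ g ∈ s, g.1 Y, scottContinuous_union s⟩ :=
      hf.2 fun g hg => scottMap_le_of_forall fun Y => Set.subset_biUnion_of_mem
        (u := fun g : ScottMap (Set G.carrier) (Set G.carrier) => g.1 Y) hg
    have h' := hle (a : Set G.carrier) h
    simp only [Set.mem_iUnion] at h'
    obtain ⟨g, hg, hα⟩ := h'
    exact hB ⟨g, hg, rfl⟩ ⟨a, α, rfl, hα⟩

/-- The reflexive object `(𝒫(G), ⊆, A, λ)` generated by a graph model. -/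
def reflexive : ReflexiveObject (Set G.carrier) where
  app := ⟨fun X => ⟨G.appSet X, G.appSet_continuous X⟩, G.appMap_continuous⟩
  lam := ⟨fun f => G.lamSet f.1, G.lamMap_continuous⟩
  app_lam f := by
    refine Subtype.ext (funext fun Y => Set.ext fun α => ⟨?_, ?_⟩)
    · rintro ⟨a, ha, b, β, h, hβ⟩
      obtain ⟨rfl, rfl⟩ := G.inj _ _ _ _ h
      exact f.2.monotone ha hβ
    · intro hα
      by_contra hcon
      have hsub := (f.2 (d := {Z : Set G.carrier | Z.Finite ∧ Z ⊆ Y}) ⟨∅, by simp⟩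
        (fun Z hZ W hW => ⟨Z ∪ W, ⟨hZ.1.union hW.1, Set.union_subset hZ.2 hW.2⟩,
          Set.subset_union_left, Set.subset_union_right⟩)
        (a := Y) ⟨fun Z hZ => hZ.2, fun B hB y hy =>
          hB (a := {y}) ⟨Set.finite_singleton y, by simpa using hy⟩ rfl⟩).2
      have hB : f.1 Y ≤ {α}ᶜ := hsub (by
        rintro _ ⟨Z, ⟨hfin, hZ⟩, rfl⟩ β hβ hβα
        obtain rfl : β = α := hβα
        exact hcon ⟨hfin.toFinset, by simpa using hZ, hfin.toFinset, β, rfl, by simpa using hβ⟩)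
      exact hB hα rfl

/-- A graph model is effective if the reflexive object it generates is effective, for some
numeration of the compact elements of `𝒫(G)`. -/
def IsEffective : Prop := ∃ d : ℕ → Set G.carrier, IsEffectiveModel G.reflexive d

end GraphModel

/-! ### Partial pairs and their completions -/

/-- A partial pair: a set `A` with a partial injective function `c : A* × A ⇀ A`, given by its
graph (`graph a α β` means that `c(a, α)` is defined and equal to `β`). -/
structure PartialPair : Type (u + 1) where
  carrier : Type u
  graph : Finset carrier → carrier → carrier → Prop
  functional : ∀ a α β β', graph a α β → graph a α β' → β = β'
  inj : ∀ a α b β γ, graph a α γ → graph b β γ → a = b ∧ α = β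

/-- The disjoint union of a family of partial pairs. -/
def PartialPair.disjointUnion {ι : Type u} (A : ι → PartialPair.{u}) : PartialPair.{u} where
  carrier := Σ i, (A i).carrier
  graph a α β := ∃ (i : ι) (b : Finset (A i).carrier) (x y : (A i).carrier), (A i).graph b x y ∧
    a = b.map (Function.Embedding.sigmaMk i) ∧ α = ⟨i, x⟩ ∧ β = ⟨i, y⟩
  functional := by
    rintro _ _ _ _ ⟨i, b, x, y, h, rfl, rfl, rfl⟩ ⟨j, b', x', y', h', hb, hx, rfl⟩
    obtain ⟨rfl, hx⟩ := Sigma.mk.inj_iff.1 hx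
    obtain rfl := eq_of_heq hx
    obtain rfl := Finset.map_injective _ hb
    rw [(A i).functional _ _ _ _ h h']
  inj := by
    rintro _ _ _ _ _ ⟨i, b, x, y, h, rfl, rfl, rfl⟩ ⟨j, b', x', y', h', rfl, rfl, hy⟩
    obtain ⟨rfl, hy⟩ := Sigma.mk.inj_iff.1 hy
    obtain rfl := eq_of_heq hy
    obtain ⟨rfl, rfl⟩ := (A i).inj _ _ _ _ _ h h'
    exact ⟨rfl, rfl⟩

/-- Raw trees built from atoms `a : A` by forming pairs (finite family of trees, tree). -/
inductive RawTree (A : Type u) : Type u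
  | atom (a : A) : RawTree A
  | node (n : ℕ) (f : Fin n → RawTree A) (x : RawTree A) : RawTree A

namespace RawTree

variable {A : Type u}

/-- Extensional equality of raw trees: the first component of a pair counts only as a set. -/
def Equiv : RawTree A → RawTree A → Prop
  | atom a, atom b => a = b
  | node _ f x, node _ g y =>
      (∀ i, ∃ j, Equiv (f i) (g j)) ∧ (∀ j, ∃ i, Equiv (f i) (g j)) ∧ Equiv x y
  | atom _, node _ _ _ => False
  | node _ _ _, atom _ => False

theorem Equiv.refl : ∀ t : RawTree A, Equiv t t
  | atom _ => rfl
  | node _ f x => ⟨fun i => ⟨i, Equiv.refl (f i)⟩, fun i => ⟨i, Equiv.refl (f i)⟩, Equiv.refl x⟩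

theorem Equiv.symm : ∀ {s t : RawTree A}, Equiv s t → Equiv t s
  | atom _, atom _, h => Eq.symm h
  | node _ _ _, node _ _ _, ⟨h₁, h₂, h₃⟩ =>
    ⟨fun j => (h₂ j).imp fun _ h => Equiv.symm h, fun i => (h₁ i).imp fun _ h => Equiv.symm h,
      Equiv.symm h₃⟩

theorem Equiv.trans : ∀ {r s t : RawTree A}, Equiv r s → Equiv s t → Equiv r t
  | atom _, atom _, atom _, h, k => Eq.trans h k
  | node _ _ _, node _ _ _, node _ _ _, ⟨h₁, h₂, h₃⟩, ⟨k₁, k₂, k₃⟩ =>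
    ⟨fun i => let ⟨j, hj⟩ := h₁ i; let ⟨l, hl⟩ := k₁ j; ⟨l, Equiv.trans hj hl⟩,
      fun l => let ⟨j, hj⟩ := k₂ l; let ⟨i, hi⟩ := h₂ j; ⟨i, Equiv.trans hi hj⟩,
      Equiv.trans h₃ k₃⟩

instance setoid (A : Type u) : Setoid (RawTree A) where
  r := Equiv
  iseqv := ⟨Equiv.refl, Equiv.symm, Equiv.trans⟩

end RawTree

/-- The universe of all objects that are obtained from atoms `a : A` by forming pairs
`(finite set of objects, object)`. -/
def HTree (A : Type u) : Type u := Quotient (RawTree.setoid A)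

namespace HTree

variable {A : Type u}

theorem mk_atom_injective :
    Function.Injective fun a : A => (⟦RawTree.atom a⟧ : HTree A) := by
  intro a b h
  exact (Quotient.exact h : RawTree.Equiv _ _)

/-- The atoms. -/
def atom : A ↪ HTree A := ⟨fun a => ⟦RawTree.atom a⟧, mk_atom_injective⟩

/-- The pair `(s, x)`. -/
def pair (s : Finset (HTree A)) (x : HTree A) : HTree A :=
  ⟦RawTree.node s.card (fun i => (s.equivFin.symm i).1.out) x.out⟧

theorem pair_injective {s t : Finset (HTree A)} {x y : HTree A} (h : pair s x = pair t y) :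
    s = t ∧ x = y := by
  obtain ⟨h₁, h₂, h₃⟩ := (Quotient.exact h : RawTree.Equiv _ _)
  have key : ∀ u v : HTree A, RawTree.Equiv u.out v.out → u = v := fun u v huv =>
    Quotient.out_equiv_out.1 huv
  refine ⟨Finset.Subset.antisymm (fun u hu => ?_) (fun u hu => ?_), key _ _ h₃⟩
  · obtain ⟨j, hj⟩ := h₁ (s.equivFin ⟨u, hu⟩)
    have := key _ _ hj
    rw [Equiv.symm_apply_apply] at this
    have hu' : u = (t.equivFin.symm j).1 := this
    rw [hu']
    exact (t.equivFin.symm j).2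
  · obtain ⟨j, hj⟩ := h₂ (t.equivFin ⟨u, hu⟩)
    have := key _ _ hj
    rw [Equiv.symm_apply_apply] at this
    have hu' : (s.equivFin.symm j).1 = u := this
    rw [← hu']
    exact (s.equivFin.symm j).2

theorem pair_ne_atom {s : Finset (HTree A)} {x : HTree A} {a : A} : pair s x ≠ atom a := by
  intro h
  exact (Quotient.exact h : RawTree.Equiv _ _)

end HTree

namespace PartialPair

variable (A : PartialPair.{u})

/-- The partial function `c_A`, read on the atoms: `A.atomGraph s x γ` means that
`c_A(s, x)` is defined and equal to `γ`. -/
def atomGraph (s : Finset (HTree A.carrier)) (x : HTree A.carrier) (γ : A.carrier) : Prop :=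
  ∃ (a : Finset A.carrier) (α : A.carrier), A.graph a α γ ∧ s = a.map HTree.atom ∧
    x = HTree.atom α

/-- `E₀ = A` and `E_{n+1} = E_n ∪ ((E_n* × E_n) - dom(c_A))`. -/
def level : ℕ → Set (HTree A.carrier)
  | 0 => Set.range HTree.atom
  | n + 1 => level n ∪ {t | ∃ (s : Finset (HTree A.carrier)) (x : HTree A.carrier),
      t = HTree.pair s x ∧ (s : Set (HTree A.carrier)) ⊆ level n ∧ x ∈ level n ∧
      ¬ ∃ γ, A.atomGraph s x γ}

/-- The carrier of the completion, `E = ⋃ₙ E_n`. -/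
abbrev Completion : Type u := {t : HTree A.carrier // ∃ n, t ∈ A.level n}

theorem level_mono : Monotone A.level :=
  monotone_nat_of_le_succ fun _ => Set.subset_union_left

theorem pair_mem (s : Finset A.Completion) (x : A.Completion)
    (h : ¬ ∃ γ, A.atomGraph (s.map (Function.Embedding.subtype _)) x.1 γ) :
    ∃ n, HTree.pair (s.map (Function.Embedding.subtype _)) x.1 ∈ A.level n := by
  choose r hr using fun t : A.Completion => t.2
  refine ⟨max (s.sup r) (r x) + 1, Or.inr ⟨_, _, rfl, ?_, ?_, h⟩⟩
  · intro t ht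
    obtain ⟨t, ht', rfl⟩ := Finset.mem_map.1 (Finset.mem_coe.1 ht)
    exact A.level_mono ((Finset.le_sup (f := r) ht').trans (le_max_left _ _)) (hr t)
  · exact A.level_mono (le_max_right _ _) (hr x)

open Classical in
/-- The function of the completion: `c(s, x) = c_A(s, x)` if `c_A(s, x)` is defined, and
`c(s, x) = (s, x)` otherwise. -/
def completionFun (s : Finset A.Completion) (x : A.Completion) : A.Completion :=
  if h : ∃ γ, A.atomGraph (s.map (Function.Embedding.subtype _)) x.1 γ
  then ⟨HTree.atom h.choose, 0, Set.mem_range_self _⟩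
  else ⟨HTree.pair (s.map (Function.Embedding.subtype _)) x.1, A.pair_mem s x h⟩

theorem completionFun_of_dom {s : Finset A.Completion} {x : A.Completion}
    (h : ∃ γ, A.atomGraph (s.map (Function.Embedding.subtype _)) x.1 γ) :
    ∃ γ, A.atomGraph (s.map (Function.Embedding.subtype _)) x.1 γ ∧
      (A.completionFun s x).1 = HTree.atom γ :=
  ⟨h.choose, h.choose_spec, by rw [completionFun, dif_pos h]⟩

theorem completionFun_of_not_dom {s : Finset A.Completion} {x : A.Completion}
    (h : ¬ ∃ γ, A.atomGraph (s.map (Function.Embedding.subtype _)) x.1 γ) :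
    (A.completionFun s x).1 = HTree.pair (s.map (Function.Embedding.subtype _)) x.1 := by
  rw [completionFun, dif_neg h]

theorem completionFun_injective (s : Finset A.Completion) (x : A.Completion)
    (t : Finset A.Completion) (y : A.Completion)
    (h : A.completionFun s x = A.completionFun t y) : s = t ∧ x = y := by
  have key : s.map (Function.Embedding.subtype _) = t.map (Function.Embedding.subtype _) ∧
      x.1 = y.1 := by
    have h := congrArg Subtype.val h
    by_cases h₁ : ∃ γ, A.atomGraph (s.map (Function.Embedding.subtype _)) x.1 γ <;>
    by_cases h₂ : ∃ γ, A.atomGraph (t.map (Function.Embedding.subtype _)) y.1 γ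
    · obtain ⟨γ, ⟨a, α, hg, hs, hx⟩, e₁⟩ := A.completionFun_of_dom h₁
      obtain ⟨δ, ⟨b, β, hg', ht, hy⟩, e₂⟩ := A.completionFun_of_dom h₂
      obtain rfl := HTree.atom.injective (e₁.symm.trans (h.trans e₂))
      obtain ⟨rfl, rfl⟩ := A.inj _ _ _ _ _ hg hg'
      exact ⟨hs.trans ht.symm, hx.trans hy.symm⟩
    · obtain ⟨γ, -, e₁⟩ := A.completionFun_of_dom h₁
      exact absurd ((A.completionFun_of_not_dom h₂).symm.trans (h.symm.trans e₁))
        HTree.pair_ne_atom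
    · obtain ⟨γ, -, e₂⟩ := A.completionFun_of_dom h₂
      exact absurd ((A.completionFun_of_not_dom h₁).symm.trans (h.trans e₂))
        HTree.pair_ne_atom
    · exact HTree.pair_injective
        ((A.completionFun_of_not_dom h₁).symm.trans (h.trans (A.completionFun_of_not_dom h₂)))
  exact ⟨Finset.map_injective _ key.1, Subtype.ext key.2⟩

theorem completion_infinite [hA : Nonempty A.carrier] : Infinite A.Completion := by
  by_contra hfin
  have : Finite A.Completion := not_infinite_iff_finite.1 hfin
  have : Fintype A.Completion := Fintype.ofFinite _
  have hinj : Function.Injective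
      fun p : Finset A.Completion × A.Completion => A.completionFun p.1 p.2 := by
    rintro ⟨s, x⟩ ⟨t, y⟩ h
    obtain ⟨rfl, rfl⟩ := A.completionFun_injective s x t y h
    rfl
  have hle := Fintype.card_le_of_injective _ hinj
  rw [Fintype.card_prod, Fintype.card_finset] at hle
  have hlt := Nat.lt_two_pow_self (n := Fintype.card A.Completion)
  have hpos : 0 < Fintype.card A.Completion :=
    Fintype.card_pos_iff.2 ⟨⟨HTree.atom hA.some, 0, Set.mem_range_self _⟩⟩
  nlinarith

/-- The completion of a (non-empty) partial pair. -/
def completion [Nonempty A.carrier] : GraphModel.{u} where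
  carrier := A.Completion
  infinite := A.completion_infinite
  c := A.completionFun
  inj := A.completionFun_injective

end PartialPair

/-! ### Enumerations of the finite partial pairs on `ℕ` -/

/-- A finite partial pair whose carrier is a subset of `ℕ`; `((a, α), β) ∈ graph` means that
`c(a, α)` is defined and equal to `β`. -/
structure FinPartialPair where
  carrier : Finset ℕ
  graph : Finset ((Finset ℕ × ℕ) × ℕ)
  closed : ∀ a α β, ((a, α), β) ∈ graph → a ⊆ carrier ∧ α ∈ carrier ∧ β ∈ carrier
  functional : ∀ a α β β', ((a, α), β) ∈ graph → ((a, α), β') ∈ graph → β = β'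
  inj : ∀ a α b β γ, ((a, α), γ) ∈ graph → ((b, β), γ) ∈ graph → a = b ∧ α = β

/-- A finite partial pair on `ℕ`, as a partial pair. -/
def FinPartialPair.toPartialPair (F : FinPartialPair) : PartialPair.{0} where
  carrier := {x : ℕ // x ∈ F.carrier}
  graph a α β := ((a.map (Function.Embedding.subtype _), α.1), β.1) ∈ F.graph
  functional a α β β' h h' := Subtype.ext (F.functional _ _ _ _ h h')
  inj a α b β γ h h' := by
    obtain ⟨h₁, h₂⟩ := F.inj _ _ _ _ _ h h'
    exact ⟨Finset.map_injective _ h₁, Subtype.ext h₂⟩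

/-- An effective enumeration of all finite partial pairs on `ℕ`: the `k`-th pair (its carrier and
the graph of its function) can be computed from `k` as an explicit finite object. -/
structure EffectiveEnumeration where
  pair : ℕ → FinPartialPair
  surjective : Function.Surjective pair
  computable : ∃ g : ℕ → List ℕ × List ((List ℕ × ℕ) × ℕ), Computable g ∧ ∀ k,
    (pair k).carrier = (g k).1.toFinset ∧
    (pair k).graph = ((g k).2.map fun q => ((q.1.1.toFinset, q.1.2), q.2)).toFinset

namespace EffectiveEnumeration

variable (N : EffectiveEnumeration)

/-- The disjoint union of all the enumerated finite partial pairs. -/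
def union : PartialPair.{0} := PartialPair.disjointUnion fun k => (N.pair k).toPartialPair

instance union_nonempty : Nonempty N.union.carrier := by
  obtain ⟨k, hk⟩ := N.surjective ⟨{0}, ∅, by simp, by simp, by simp⟩
  exact ⟨⟨k, ⟨0, by simp [hk]⟩⟩⟩

/-- The completion of the disjoint union of all the enumerated finite partial pairs. -/
def model : GraphModel.{0} := N.union.completion

end EffectiveEnumeration

end LambdaGraph

end

/-! Minimality. Suppose that `α` lies in the interpretation of `M` in a graph model `G`. Only
finitely many elements of `G` and finitely many values of its function are needed to see this
(`exists_finite_witness`). They form a finite partial pair, which up to renaming is one of the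
components of the disjoint union. Hence `α` has a copy in the completion, and this copy lies in the
interpretation of `M`, in the environment that consists of the copies of the relevant points only.
If `M ⊑ L` holds in the completion, the copy also lies in the interpretation of `L`.

To return to `G`, a partial map `θ` sends each atom of the chosen component to its original, is
undefined on the atoms of all other components, and satisfies `θ(c(s, x)) = c(θ(s), θ(x))`, defined
exactly when `θ(x)` is; undefined members of `s` are dropped. Each entry of the partial function
stays inside one component, so this is consistent. Such a map carries interpretations into
interpretations (`image_interp_subset`), so `α` lies in the interpretation of `L` in `G`. The
equational statement follows, an equation being two inequalities.

Effectivity. An atom gets an even code made from its component and its number, a pair `(s, x)` the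
odd code `2⟨s, x⟩ + 1`, where `s` is written as a binary number. The parts of a pair have smaller
codes, so the set of codes is decidable by strong recursion, and the inverse of `c` is computable on
codes. With finite sets coded in binary, all conditions on an effective model become bounded
quantifications (`isEffective_of_code`).

Bijective enumeration. Finite partial pairs correspond bijectively to an infinite decidable set of
numbers, which can be listed in increasing order. -/

namespace ComputablePred

/-! ### Closure properties of computable predicates -/

variable {α β : Type*} [Primcodable α] [Primcodable β]

theorem and {p q : α → Prop} (hp : ComputablePred p) (hq : ComputablePred q) :
    ComputablePred fun a => p a ∧ q a := by
  obtain ⟨f, hf, rfl⟩ := computable_iff.1 hp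
  obtain ⟨g, hg, rfl⟩ := computable_iff.1 hq
  exact computable_iff.2 ⟨fun a => f a && g a, Primrec.and.to_comp.comp hf hg, by simp⟩

theorem or {p q : α → Prop} (hp : ComputablePred p) (hq : ComputablePred q) :
    ComputablePred fun a => p a ∨ q a :=
  (hp.not.and hq.not).not.of_eq fun a => by tauto

theorem imp {p q : α → Prop} (hp : ComputablePred p) (hq : ComputablePred q) :
    ComputablePred fun a => p a → q a :=
  (hp.not.or hq).of_eq fun a => by tauto

theorem comp {p : β → Prop} (hp : ComputablePred p) {f : α → β} (hf : Computable f) :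
    ComputablePred fun a => p (f a) := by
  obtain ⟨g, hg, rfl⟩ := computable_iff.1 hp
  exact computable_iff.2 ⟨fun a => g (f a), hg.comp hf, rfl⟩

theorem of_primrecRel {R : β → β → Prop} (hR : PrimrecRel R) {f g : α → β} (hf : Computable f)
    (hg : Computable g) : ComputablePred fun a => R (f a) (g a) :=
  comp (p := fun q : β × β => R q.1 q.2) (PrimrecPred.computablePred hR) (hf.pair hg)

theorem eq [DecidableEq β] {f g : α → β} (hf : Computable f) (hg : Computable g) :
    ComputablePred fun a => f a = g a :=
  of_primrecRel Primrec.eq hf hg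

theorem if_then_else {p : α → Prop} [DecidablePred p] (hp : ComputablePred p) {f g : α → β}
    (hf : Computable f) (hg : Computable g) : Computable fun a => if p a then f a else g a :=
  (hp.decide.cond hf hg).of_eq fun a => by by_cases h : p a <;> simp [h]

theorem forall_lt {p : α → ℕ → Prop} (hp : ComputablePred fun q : α × ℕ => p q.1 q.2)
    {f : α → ℕ} (hf : Computable f) : ComputablePred fun a => ∀ i < f a, p a i := by
  classical
  have h : Computable fun a => (Nat.rec true (fun i b => b && decide (p a i)) (f a) : Bool) :=
    Computable.nat_rec hf (Computable.const true) (h := fun a ib => ib.2 && decide (p a ib.1))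
      (Primrec.and.to_comp.comp (Computable.snd.comp Computable.snd)
        (hp.decide.comp (Computable.fst.pair (Computable.fst.comp Computable.snd))))
  refine computable_iff.2 ⟨_, h, funext fun a => propext ?_⟩
  generalize f a = n
  induction n with
  | zero => simp
  | succ n ih => rw [Nat.forall_lt_succ_right, ih]; simp

theorem forall_mem_list {p : α → β → Prop} (hp : ComputablePred fun q : α × β => p q.1 q.2)
    {f : α → List β} (hf : Computable f) : ComputablePred fun a => ∀ b ∈ f a, p a b := by
  classical
  -- Quantification over a list becomes bounded quantification over indices; the default `true`
  -- makes an index past the end harmless.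
  have h : ComputablePred fun q : α × ℕ => ∀ b ∈ (f q.1)[q.2]?, p q.1 b := by
    have h₁ : Computable fun q : α × ℕ => (f q.1)[q.2]? :=
      Computable.list_getElem?.comp (hf.comp Computable.fst) Computable.snd
    have h₂ : ComputablePred fun r : (α × ℕ) × β => p r.1.1 r.2 :=
      comp (p := fun q : α × β => p q.1 q.2) hp
        (f := fun r : (α × ℕ) × β => (r.1.1, r.2))
        ((Computable.fst.comp Computable.fst).pair Computable.snd)
    have hb : Computable fun q : α × ℕ => ((f q.1)[q.2]?.map fun b => decide (p q.1 b)).getD true :=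
      Computable.option_getD (Computable.option_map h₁ h₂.decide.to₂) (Computable.const true)
    refine computable_iff.2 ⟨_, hb, funext fun q => propext ?_⟩
    cases (f q.1)[q.2]? <;> simp
  refine (forall_lt (p := fun a i => ∀ b ∈ (f a)[i]?, p a b) h
    (Computable.list_length.comp hf)).of_eq fun a => ?_
  constructor
  · intro H b hb
    obtain ⟨i, hi, rfl⟩ := List.getElem_of_mem hb
    exact H i hi _ (by simp [hi])
  · intro H i hi b hb
    exact H b (List.mem_of_getElem? hb)

theorem exists_mem_list {p : α → β → Prop} (hp : ComputablePred fun q : α × β => p q.1 q.2)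
    {f : α → List β} (hf : Computable f) : ComputablePred fun a => ∃ b ∈ f a, p a b :=
  (forall_mem_list (p := fun a b => ¬ p a b) hp.not hf).not.of_eq fun a => by simp

end ComputablePred

/-- The elements of an infinite decidable set of natural numbers can be listed computably in
increasing order. -/
theorem Computable.nat_nth {p : ℕ → Prop} (hp : ComputablePred p)
    (hinf : {n | p n}.Infinite) : Computable (Nat.nth p) := by
  classical
  have hc : Computable (Nat.count p) := by
    refine (Computable.nat_rec (f := id) (g := fun _ : ℕ => 0)
      (h := fun _ q => q.2 + if p q.1 then 1 else 0) Computable.id (Computable.const 0)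
      (Primrec.nat_add.to_comp.comp (Computable.snd.comp Computable.snd)
        ((hp.comp (Computable.fst.comp Computable.snd)).if_then_else (Computable.const 1)
          (Computable.const 0)))).of_eq fun n => ?_
    induction n with
    | zero => simp
    | succ n ih => simpa [Nat.count_succ] using ih
  have hP : ComputablePred fun q : ℕ × ℕ => p q.2 ∧ Nat.count p q.2 = q.1 :=
    (hp.comp Computable.snd).and (ComputablePred.eq (hc.comp Computable.snd) Computable.fst)
  have hex : ∀ n, ∃ m, p m ∧ Nat.count p m = n := fun n =>
    ⟨Nat.nth p n, Nat.nth_mem_of_infinite hinf n, Nat.count_nth_of_infinite hinf n⟩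
  -- Unbounded search for the element of the set with exactly `n` smaller elements; it terminates
  -- because the set is infinite.
  refine (Computable.find (P := fun n m => p m ∧ Nat.count p m = n) hP hex).of_eq fun n => ?_
  obtain ⟨h₁, h₂⟩ := Nat.find_spec (hex n)
  conv_rhs => rw [← h₂]
  exact (Nat.nth_count h₁).symm

/-! ### Finite sets of natural numbers as binary numbers -/

/-- The number with binary digits `1` exactly at the places in `s`. -/
def setCode (s : Finset ℕ) : ℕ := Finset.equivBitIndices.symm s

theorem testBit_iff_mem_equivBitIndices {n i : ℕ} :
    n.testBit i = true ↔ i ∈ Finset.equivBitIndices n := by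
  simp [Finset.equivBitIndices]

@[simp] theorem testBit_setCode {s : Finset ℕ} {i : ℕ} :
    (setCode s).testBit i = true ↔ i ∈ s := by
  rw [testBit_iff_mem_equivBitIndices, setCode, Equiv.apply_symm_apply]

/-- Since `i < 2 ^ i ≤ n`. This bounds every quantifier over binary digits and makes the codes of
members smaller than the code of a set. -/
theorem lt_of_testBit {n i : ℕ} (h : n.testBit i = true) : i < n :=
  Nat.lt_two_pow_self.trans_le (Nat.ge_two_pow_of_testBit h)

theorem setCode_insert {s : Finset ℕ} {i : ℕ} (hi : i ∉ s) :
    setCode (insert i s) = 2 ^ i + setCode s :=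
  Finset.sum_insert hi

theorem setCode_singleton (i : ℕ) : setCode {i} = 2 ^ i := by
  simp [setCode, Finset.equivBitIndices]

theorem Primrec.two_pow : Primrec fun n : ℕ => 2 ^ n := by
  refine (Primrec.nat_rec₁ (f := fun _ x => 2 * x) 1
    (Primrec.nat_mul.comp (Primrec.const 2) Primrec.snd).to₂).of_eq fun n => ?_
  induction n with
  | zero => rfl
  | succ n ih => rw [pow_succ']; simpa using ih

theorem PrimrecRel.testBit : PrimrecRel fun n i : ℕ => n.testBit i = true := by
  have h : PrimrecRel fun n i : ℕ => n / 2 ^ i % 2 = 1 :=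
    Primrec.eq.comp (Primrec.nat_mod.comp (Primrec.nat_div.comp Primrec.fst
      (Primrec.two_pow.comp Primrec.snd)) (Primrec.const 2)) (Primrec.const 1)
  exact h.of_eq fun n i => by simp [Nat.testBit_eq_decide_div_mod_eq]

theorem ComputablePred.testBit {α : Type*} [Primcodable α] {f g : α → ℕ} (hf : Computable f)
    (hg : Computable g) : ComputablePred fun a => (f a).testBit (g a) = true :=
  ComputablePred.comp (p := fun q : ℕ × ℕ => q.1.testBit q.2 = true)
    (PrimrecPred.computablePred PrimrecRel.testBit) (hf.pair hg)

/-- Bounded universal quantification over the places of the binary digits `1`. -/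
theorem ComputablePred.forall_testBit {α : Type*} [Primcodable α] {p : α → ℕ → Prop}
    (hp : ComputablePred fun q : α × ℕ => p q.1 q.2) {f : α → ℕ} (hf : Computable f) :
    ComputablePred fun a => ∀ i, (f a).testBit i = true → p a i :=
  (forall_lt (p := fun a i => (f a).testBit i = true → p a i)
    ((testBit (hf.comp Computable.fst) Computable.snd).imp hp) hf).of_eq fun _ =>
      ⟨fun H i hi => H i (lt_of_testBit hi) hi, fun H i _ hi => H i hi⟩

theorem ComputablePred.exists_testBit {α : Type*} [Primcodable α] {p : α → ℕ → Prop}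
    (hp : ComputablePred fun q : α × ℕ => p q.1 q.2) {f : α → ℕ} (hf : Computable f) :
    ComputablePred fun a => ∃ i, (f a).testBit i = true ∧ p a i :=
  (forall_testBit (p := fun a i => ¬ p a i) hp.not hf).not.of_eq fun a => by simp

open Classical in
/-- A set of natural numbers is decidable if membership of `n` can be decided from `n` and the
finite set of all smaller elements. -/
theorem ComputablePred.of_strong_rec {p : ℕ → Prop} {q : ℕ × ℕ → Prop} (hq : ComputablePred q)
    (h : ∀ n, p n ↔ q (n, setCode {i ∈ Finset.range n | p i})) : ComputablePred p := by
  have hF : Computable fun n => setCode {i ∈ Finset.range n | p i} := by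
    -- The recursion carries the whole history as one binary number: stage `n` adds `2 ^ n` or
    -- nothing, the digit at `n` being still free.
    refine (Computable.nat_rec (f := id) (g := fun _ : ℕ => 0)
      (h := fun _ r => (if q r then 2 ^ r.1 else 0) + r.2) Computable.id (Computable.const 0)
      (Primrec.nat_add.to_comp.comp ((hq.comp Computable.snd).if_then_else
        (Primrec.two_pow.to_comp.comp (Computable.fst.comp Computable.snd)) (Computable.const 0))
        (Computable.snd.comp Computable.snd))).of_eq fun n => ?_
    induction n with
    | zero => simp [setCode]
    | succ n ih =>
      simp only [id_eq] at ih ⊢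
      rw [ih, Finset.range_add_one, Finset.filter_insert]
      by_cases hn : p n
      · rw [if_pos hn, if_pos ((h n).1 hn), setCode_insert (by simp)]
      · rw [if_neg hn, if_neg (mt (h n).2 hn), zero_add]
  exact (hq.comp (Computable.id.pair hF)).of_eq fun n => (h n).symm

/-- The list may have repetitions, so the fold adds `2 ^ i` only when that digit is not yet set. -/
theorem Primrec.setCode_toFinset : Primrec fun l : List ℕ => setCode l.toFinset := by
  have hstep : Primrec₂ fun (_ : List ℕ) (q : ℕ × ℕ) =>
      if q.2.testBit q.1 = true then q.2 else 2 ^ q.1 + q.2 := by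
    refine (Primrec.ite (PrimrecRel.testBit.comp Primrec.snd Primrec.fst) Primrec.snd
      (Primrec.nat_add.comp (Primrec.two_pow.comp Primrec.fst) Primrec.snd)).comp Primrec.snd
  refine (Primrec.list_foldr Primrec.id (Primrec.const 0) hstep).of_eq fun l => ?_
  induction l with
  | nil => simp [setCode]
  | cons i l ih =>
    simp only [id_eq, List.foldr_cons, List.toFinset_cons] at ih ⊢
    rw [ih]
    by_cases hi : i ∈ l.toFinset
    · rw [if_pos (testBit_setCode.2 hi), Finset.insert_eq_of_mem hi]
    · rw [if_neg (mt testBit_setCode.1 hi), setCode_insert hi]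

/-- The list of the places of the binary digits `1`. -/
def bitList (n : ℕ) : List ℕ := (List.range n).filter fun i => n.testBit i

theorem toFinset_bitList (n : ℕ) : (bitList n).toFinset = Finset.equivBitIndices n := by
  ext i
  simpa [bitList, ← testBit_iff_mem_equivBitIndices] using lt_of_testBit

theorem Primrec.bitList : Primrec bitList := by
  have h := (PrimrecRel.listFilter (R := fun i n : ℕ => n.testBit i = true)
    (PrimrecRel.testBit.comp Primrec.snd Primrec.fst)).comp Primrec.list_range Primrec.id
  exact h.of_eq fun n => by simp [_root_.bitList]

/-! ### A bijective enumeration of the finite partial pairs -/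

namespace LambdaGraph

namespace FinPartialPair

/-- A finite set of numbers and a finite set of triples form a finite partial pair. -/
def IsPair (r : Finset ℕ × Finset ((Finset ℕ × ℕ) × ℕ)) : Prop :=
  (∀ e ∈ r.2, e.1.1 ⊆ r.1 ∧ e.1.2 ∈ r.1 ∧ e.2 ∈ r.1) ∧
  (∀ e ∈ r.2, ∀ e' ∈ r.2, e.1 = e'.1 → e.2 = e'.2) ∧
  (∀ e ∈ r.2, ∀ e' ∈ r.2, e.2 = e'.2 → e.1 = e'.1)

/-- Finite partial pairs as pairs of finite sets. -/
def equivIsPair : {r // IsPair r} ≃ FinPartialPair where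
  toFun r :=
    { carrier := r.1.1
      graph := r.1.2
      closed := fun _ _ _ h => r.2.1 _ h
      functional := fun _ _ _ _ h h' => r.2.2.1 _ h _ h' rfl
      inj := fun _ _ _ _ _ h h' => Prod.ext_iff.1 (r.2.2.2 _ h _ h' rfl) }
  invFun F := ⟨(F.carrier, F.graph), fun _ h => F.closed _ _ _ h, by
    rintro ⟨⟨a, α⟩, β⟩ h ⟨⟨a', α'⟩, β'⟩ h' e
    obtain ⟨rfl, rfl⟩ := Prod.ext_iff.1 e
    exact F.functional _ _ _ _ h h', by
    rintro ⟨⟨a, α⟩, β⟩ h ⟨⟨a', α'⟩, β'⟩ h' rfl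
    exact Prod.ext_iff.2 (F.inj _ _ _ _ _ h h')⟩
  left_inv _ := rfl
  right_inv _ := rfl

/-- Numbers as triples. -/
def tripleEquiv : ℕ ≃ (Finset ℕ × ℕ) × ℕ :=
  Nat.pairEquiv.symm.trans
    ((Nat.pairEquiv.symm.trans (Finset.equivBitIndices.prodCongr (Equiv.refl ℕ))).prodCongr
      (Equiv.refl ℕ))

theorem tripleEquiv_apply (t : ℕ) : tripleEquiv t =
    ((Finset.equivBitIndices t.unpair.1.unpair.1, t.unpair.1.unpair.2), t.unpair.2) := rfl

/-- Numbers as pairs of a finite set of numbers and a finite set of triples. -/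
def rawEquiv : ℕ ≃ Finset ℕ × Finset ((Finset ℕ × ℕ) × ℕ) :=
  Nat.pairEquiv.symm.trans
    (Finset.equivBitIndices.prodCongr (Finset.equivBitIndices.trans tripleEquiv.finsetCongr))

theorem rawEquiv_fst (n : ℕ) : (rawEquiv n).1 = Finset.equivBitIndices n.unpair.1 := rfl

theorem rawEquiv_snd (n : ℕ) : (rawEquiv n).2 =
    (Finset.equivBitIndices n.unpair.2).map tripleEquiv.toEmbedding := rfl

theorem forall_mem_rawEquiv_snd {n : ℕ} {P : (Finset ℕ × ℕ) × ℕ → Prop} :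
    (∀ e ∈ (rawEquiv n).2, P e) ↔ ∀ t, n.unpair.2.testBit t = true → P (tripleEquiv t) := by
  simp only [rawEquiv_snd, Finset.forall_mem_map, testBit_iff_mem_equivBitIndices]
  rfl

theorem computablePred_isPair : ComputablePred fun n => IsPair (rawEquiv n) := by
  have u1 {α : Type} [Primcodable α] {f : α → ℕ} (hf : Computable f) :
      Computable fun a => (f a).unpair.1 := Computable.fst.comp (Computable.unpair.comp hf)
  have u2 {α : Type} [Primcodable α] {f : α → ℕ} (hf : Computable f) :
      Computable fun a => (f a).unpair.2 := Computable.snd.comp (Computable.unpair.comp hf)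
  have h₁ : ComputablePred fun n : ℕ => ∀ t, n.unpair.2.testBit t = true →
      (∀ i, t.unpair.1.unpair.1.testBit i = true → n.unpair.1.testBit i = true) ∧
      n.unpair.1.testBit t.unpair.1.unpair.2 = true ∧ n.unpair.1.testBit t.unpair.2 = true := by
    refine .forall_testBit (p := fun n t : ℕ =>
      (∀ i, t.unpair.1.unpair.1.testBit i = true → n.unpair.1.testBit i = true) ∧
      n.unpair.1.testBit t.unpair.1.unpair.2 = true ∧ n.unpair.1.testBit t.unpair.2 = true)
      ((ComputablePred.forall_testBit (p := fun (q : ℕ × ℕ) (i : ℕ) =>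
        q.1.unpair.1.testBit i = true) ?_ (u1 (u1 .snd))).and (.and ?_ ?_)) (u2 .id)
    · exact .testBit (u1 (Computable.fst.comp .fst)) .snd
    · exact .testBit (u1 .fst) (u2 (u1 .snd))
    · exact .testBit (u1 .fst) (u2 .snd)
  have h₂ : ComputablePred fun n : ℕ => ∀ t, n.unpair.2.testBit t = true →
      ∀ t', n.unpair.2.testBit t' = true → t.unpair.1 = t'.unpair.1 → t.unpair.2 = t'.unpair.2 :=
    .forall_testBit (p := fun n t : ℕ => ∀ t', n.unpair.2.testBit t' = true →
        t.unpair.1 = t'.unpair.1 → t.unpair.2 = t'.unpair.2)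
      (.forall_testBit (p := fun (q : ℕ × ℕ) (t' : ℕ) => q.2.unpair.1 = t'.unpair.1 →
        q.2.unpair.2 = t'.unpair.2)
        ((ComputablePred.eq (u1 (Computable.snd.comp .fst)) (u1 .snd)).imp
          (ComputablePred.eq (u2 (Computable.snd.comp .fst)) (u2 .snd))) (u2 .fst)) (u2 .id)
  have h₃ : ComputablePred fun n : ℕ => ∀ t, n.unpair.2.testBit t = true →
      ∀ t', n.unpair.2.testBit t' = true → t.unpair.2 = t'.unpair.2 → t.unpair.1 = t'.unpair.1 :=
    .forall_testBit (p := fun n t : ℕ => ∀ t', n.unpair.2.testBit t' = true →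
        t.unpair.2 = t'.unpair.2 → t.unpair.1 = t'.unpair.1)
      (.forall_testBit (p := fun (q : ℕ × ℕ) (t' : ℕ) => q.2.unpair.2 = t'.unpair.2 →
        q.2.unpair.1 = t'.unpair.1)
        ((ComputablePred.eq (u2 (Computable.snd.comp .fst)) (u2 .snd)).imp
          (ComputablePred.eq (u1 (Computable.snd.comp .fst)) (u1 .snd))) (u2 .fst)) (u2 .id)
  -- The coding of triples is bijective, so arguments can be compared through their codes, without
  -- decoding finite sets.
  have key : ∀ t t' : ℕ, (tripleEquiv t).1 = (tripleEquiv t').1 ↔ t.unpair.1 = t'.unpair.1 := by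
    intro t t'
    rw [tripleEquiv_apply, tripleEquiv_apply, Prod.mk.injEq,
      Finset.equivBitIndices.injective.eq_iff, ← Prod.ext_iff]
    exact Nat.pairEquiv.symm.injective.eq_iff
  refine (h₁.and (h₂.and h₃)).of_eq fun n => ?_
  simp only [IsPair, forall_mem_rawEquiv_snd, key, Finset.subset_iff, rawEquiv_fst]
  simp only [tripleEquiv_apply, testBit_iff_mem_equivBitIndices]

/-- One-point carriers with the empty function already give infinitely many pairs. -/
theorem infinite_isPair : {n | IsPair (rawEquiv n)}.Infinite := by
  refine Set.infinite_of_injective_forall_mem (f := fun k : ℕ => rawEquiv.symm ({k}, ∅)) ?_ ?_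
  · intro k l h
    simpa using rawEquiv.symm.injective h
  · intro k
    simp [IsPair]

end FinPartialPair

open FinPartialPair in
-- Binary coding gives each finite set exactly one code, so the increasing list of the valid codes
-- meets each finite partial pair exactly once.
theorem exists_bijective_effectiveEnumeration :
    ∃ N : EffectiveEnumeration, Function.Bijective N.pair := by
  set e : ℕ → ℕ := Nat.nth fun n => IsPair (rawEquiv n) with he
  have hmem : ∀ k, IsPair (rawEquiv (e k)) := Nat.nth_mem_of_infinite infinite_isPair
  set p : ℕ → FinPartialPair := fun k => equivIsPair ⟨rawEquiv (e k), hmem k⟩ with hp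
  have hinj : Function.Injective p := by
    intro k l h
    have h' := Subtype.ext_iff.1 (equivIsPair.injective h)
    exact Nat.nth_injective infinite_isPair (rawEquiv.injective h')
  have hsurj : Function.Surjective p := by
    intro F
    obtain ⟨⟨r, hr⟩, rfl⟩ := equivIsPair.surjective F
    obtain ⟨n, rfl⟩ := rawEquiv.surjective r
    have hn : n ∈ Set.range e := by
      rw [he, Nat.range_nth_of_infinite infinite_isPair]
      exact hr
    obtain ⟨k, rfl⟩ := hn
    exact ⟨k, rfl⟩
  refine ⟨⟨p, hsurj, fun k => (bitList (e k).unpair.1, (bitList (e k).unpair.2).map fun t =>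
    ((bitList t.unpair.1.unpair.1, t.unpair.1.unpair.2), t.unpair.2)), ?_, fun k => ⟨?_, ?_⟩⟩,
    hinj, hsurj⟩
  · have h1 : Primrec fun n : ℕ => n.unpair.1 := Primrec.fst.comp Primrec.unpair
    have h2 : Primrec fun n : ℕ => n.unpair.2 := Primrec.snd.comp Primrec.unpair
    have hg : Primrec fun n : ℕ => (bitList n.unpair.1, (bitList n.unpair.2).map fun t =>
        ((bitList t.unpair.1.unpair.1, t.unpair.1.unpair.2), t.unpair.2)) :=
      (Primrec.bitList.comp h1).pair (Primrec.list_map (Primrec.bitList.comp h2)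
        ((((Primrec.bitList.comp (h1.comp h1)).pair (h2.comp h1)).pair h2).comp Primrec.snd).to₂)
    exact hg.to_comp.comp (Computable.nat_nth computablePred_isPair infinite_isPair)
  · exact (toFinset_bitList _).symm
  · change (rawEquiv (e k)).2 = _
    rw [rawEquiv_snd, List.map_map, ← toFinset_bitList]
    ext x
    simp only [Finset.mem_map, List.mem_toFinset, List.mem_map, Function.comp, toFinset_bitList]
    refine exists_congr fun t => and_congr ?_ Iff.rfl
    rw [← toFinset_bitList, List.mem_toFinset]

end LambdaGraph

/-! ### Finite witnesses and maps that preserve interpretations -/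

namespace LambdaGraph

namespace GraphModel

/-- Membership in the interpretation of a term is witnessed by a finite part of the model: it is
preserved by all maps to graph models that preserve this part. -/
theorem exists_finite_witness (G : GraphModel.{u}) (M : LamTerm) {ρ : ℕ → Set G.carrier}
    {α : G.carrier} (hα : α ∈ G.interp M ρ) :
    ∃ F : Set G.carrier, F.Finite ∧ α ∈ F ∧ ∀ (H : GraphModel.{v}) (j : G.carrier → H.carrier)
      (σ : ℕ → Set H.carrier),
      (∀ (a : Finset G.carrier) (β : G.carrier) (b : Finset H.carrier), ↑a ⊆ F → β ∈ F →
        G.c a β ∈ F → (b : Set H.carrier) = j '' a → j (G.c a β) = H.c b (j β)) →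
      (∀ x, j '' (F ∩ ρ x) ⊆ σ x) → j α ∈ H.interp M σ := by
  classical
  induction M generalizing ρ α with
  | var x =>
    refine ⟨{α}, Set.finite_singleton α, rfl, fun H j σ _ hσ => hσ x ⟨α, ⟨rfl, hα⟩, rfl⟩⟩
  | app M N ihM ihN =>
    obtain ⟨a, ha, hM⟩ := hα
    obtain ⟨F, hF, hcF, hFM⟩ := ihM hM
    -- The argument set `a` is finite, so the witnesses of all its elements still have a finite
    -- union.
    choose K hK hβK hKN using fun β : a => ihN (ha β.2)
    refine ⟨insert α (F ∪ ⋃ β, K β), ((hF.union (Set.finite_iUnion hK)).insert α),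
      Set.mem_insert _ _, fun H j σ hj hσ => ?_⟩
    have hFs : F ⊆ insert α (F ∪ ⋃ β, K β) :=
      Set.subset_union_left.trans (Set.subset_insert _ _)
    have hKs : ∀ β, K β ⊆ insert α (F ∪ ⋃ β, K β) := fun β =>
      (Set.subset_iUnion K β).trans (Set.subset_union_right.trans (Set.subset_insert _ _))
    refine ⟨a.image j, ?_, ?_⟩
    · intro y hy
      obtain ⟨β, hβ, rfl⟩ := Finset.mem_image.1 (Finset.mem_coe.1 hy)
      exact hKN ⟨β, hβ⟩ H j σ
        (fun b γ b' hb hγ hc => hj b γ b' (hb.trans (hKs _)) (hKs _ hγ) (hKs _ hc))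
        (fun x => (Set.image_mono (Set.inter_subset_inter_left _ (hKs _))).trans (hσ x))
    -- Preservation of `c(a, α)` may be used because `a`, `α` and `c(a, α)` were all put into the
    -- finite part.
    · rw [← hj a α _ (fun β hβ => hKs ⟨β, hβ⟩ (hβK ⟨β, hβ⟩)) (Set.mem_insert _ _) (hFs hcF)
        Finset.coe_image]
      exact hFM H j σ
        (fun b γ b' hb hγ hc => hj b γ b' (hb.trans hFs) (hFs hγ) (hFs hc))
        (fun x => (Set.image_mono (Set.inter_subset_inter_left _ hFs)).trans (hσ x))
  | lam x M ih =>
    obtain ⟨a, α, rfl, hα⟩ := hα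
    obtain ⟨F, hF, hαF, hFM⟩ := ih hα
    refine ⟨insert (G.c a α) (F ∪ a), (hF.union a.finite_toSet).insert _, Set.mem_insert _ _,
      fun H j σ hj hσ => ?_⟩
    have hFs : F ⊆ insert (G.c a α) (F ∪ a) := Set.subset_union_left.trans (Set.subset_insert _ _)
    refine ⟨a.image j, j α, hj a α _ (Set.subset_union_right.trans (Set.subset_insert _ _))
      (hFs hαF) (Set.mem_insert _ _) Finset.coe_image, ?_⟩
    -- At the bound variable the environment is `a` on one side and its image on the other;
    -- elsewhere it is unchanged.
    refine hFM H j _ (fun b γ b' hb hγ hc => hj b γ b' (hb.trans hFs) (hFs hγ) (hFs hc)) fun y => ?_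
    by_cases hy : y = x
    · subst hy
      simp only [Function.update_self, Finset.coe_image]
      exact Set.image_mono Set.inter_subset_right
    · simp only [Function.update_of_ne hy]
      exact (Set.image_mono (Set.inter_subset_inter_left _ hFs)).trans (hσ y)

/-- A multivalued map `θ` of graph models that takes at most one value at each point, and is
defined at `c(a, α)` if and only if it is defined at `α`, with `θ(c(a, α)) = c(θ(a), θ(α))`,
preserves interpretations. -/
theorem image_interp_subset (P : GraphModel.{v}) (G : GraphModel.{u})
    (θ : P.carrier → Set G.carrier) (hsub : ∀ t, (θ t).Finite)
    (hθ : ∀ (a : Finset P.carrier) (α : P.carrier) (b : Finset G.carrier) (β : G.carrier),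
      β ∈ θ α → (b : Set G.carrier) = ⋃ t ∈ a, θ t → G.c b β ∈ θ (P.c a α))
    (hθ' : ∀ (a : Finset P.carrier) (α : P.carrier), ∀ γ ∈ θ (P.c a α),
      ∃ (b : Finset G.carrier), ∃ β ∈ θ α, (b : Set G.carrier) = (⋃ t ∈ a, θ t) ∧ γ = G.c b β)
    (M : LamTerm) {σ : ℕ → Set P.carrier} {ρ : ℕ → Set G.carrier}
    (h : ∀ x, ∀ t ∈ σ x, θ t ⊆ ρ x) {t : P.carrier} (ht : t ∈ P.interp M σ) :
    θ t ⊆ G.interp M ρ := by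
  induction M generalizing σ ρ t with
  | var x => exact h x t ht
  | app M N ihM ihN =>
    obtain ⟨a, ha, hM⟩ := ht
    intro β hβ
    -- Points of `a` without a value contribute nothing to the union; what remains is a finite
    -- subset of the argument's interpretation.
    have hfin : (⋃ s ∈ a, θ s).Finite := a.finite_toSet.biUnion fun s _ => hsub s
    refine ⟨hfin.toFinset, ?_, ihM h hM (hθ a t _ β hβ hfin.coe_toFinset)⟩
    rw [hfin.coe_toFinset]
    exact Set.iUnion₂_subset fun s hs => ihN h (ha hs)
  | lam x M ih =>
    obtain ⟨a, α, rfl, hα⟩ := ht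
    intro γ hγ
    -- The bound variable is interpreted by `a` in `P` and by `b = θ(a)` in `G`, so the assumption
    -- on environments persists.
    obtain ⟨b, β, hβ, hb, rfl⟩ := hθ' a α γ hγ
    refine ⟨b, β, rfl, ih (fun y => ?_) hα hβ⟩
    by_cases hy : y = x
    · subst hy
      simp only [Function.update_self, hb]
      exact fun s hs => Set.subset_biUnion_of_mem (u := θ) hs
    · simpa only [Function.update_of_ne hy] using h y

end GraphModel

/-! ### Evaluating trees in a graph model -/

namespace RawTree

/-- The multivalued evaluation of a tree in a graph model that extends an evaluation of the
atoms. -/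
def eval {A : Type v} (G : GraphModel.{u}) (φ : A → Set G.carrier) : RawTree A → Set G.carrier
  | atom a => φ a
  | node _ f x => {γ | ∃ b : Finset G.carrier, ∃ β ∈ eval G φ x,
      (b : Set G.carrier) = (⋃ i, eval G φ (f i)) ∧ γ = G.c b β}

variable {A : Type v} (G : GraphModel.{u}) (φ : A → Set G.carrier)

theorem Equiv.eval_eq : ∀ {s t : RawTree A}, Equiv s t → eval G φ s = eval G φ t
  | atom _, atom _, h => congrArg φ h
  | node _ f x, node _ g y, ⟨h₁, h₂, h₃⟩ => by
    have hu : (⋃ i, eval G φ (f i)) = ⋃ j, eval G φ (g j) := by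
      refine Set.Subset.antisymm (Set.iUnion_subset fun i => ?_) (Set.iUnion_subset fun j => ?_)
      · obtain ⟨j, hj⟩ := h₁ i
        rw [Equiv.eval_eq hj]
        exact Set.subset_iUnion (fun j => eval G φ (g j)) j
      · obtain ⟨i, hi⟩ := h₂ j
        rw [← Equiv.eval_eq hi]
        exact Set.subset_iUnion (fun i => eval G φ (f i)) i
    rw [eval, eval, hu, Equiv.eval_eq h₃]

theorem subsingleton_eval (hφ : ∀ a, (φ a).Subsingleton) :
    ∀ t : RawTree A, (eval G φ t).Subsingleton
  | atom a => hφ a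
  | node _ f x => by
    rintro _ ⟨b, β, hβ, hb, rfl⟩ _ ⟨b', β', hβ', hb', rfl⟩
    rw [subsingleton_eval hφ x hβ hβ', Finset.coe_injective (hb.trans hb'.symm)]

end RawTree

namespace HTree

variable {A : Type v} (G : GraphModel.{u}) (φ : A → Set G.carrier)

/-- The multivalued evaluation of a tree in a graph model. -/
def eval (t : HTree A) : Set G.carrier :=
  Quotient.lift (RawTree.eval G φ) (fun _ _ h => RawTree.Equiv.eval_eq G φ h) t

theorem eval_atom (a : A) : eval G φ (atom a) = φ a := rfl

theorem rawTree_eval_out (t : HTree A) : RawTree.eval G φ t.out = eval G φ t := by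
  conv_rhs => rw [← Quotient.out_eq t]
  rfl

theorem mem_eval_pair {s : Finset (HTree A)} {x : HTree A} {γ : G.carrier} :
    γ ∈ eval G φ (pair s x) ↔ ∃ b : Finset G.carrier, ∃ β ∈ eval G φ x,
      (b : Set G.carrier) = (⋃ t ∈ s, eval G φ t) ∧ γ = G.c b β := by
  have h : (⋃ i, RawTree.eval G φ (s.equivFin.symm i).1.out) = ⋃ t ∈ s, eval G φ t := by
    simp only [rawTree_eval_out]
    rw [s.equivFin.symm.surjective.iUnion_comp (fun t : s => eval G φ t.1)]
    ext; simp
  change γ ∈ RawTree.eval G φ (RawTree.node _ _ _) ↔ _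
  rw [RawTree.eval, h, rawTree_eval_out]
  rfl

theorem subsingleton_eval (hφ : ∀ a, (φ a).Subsingleton) (t : HTree A) :
    (eval G φ t).Subsingleton := by
  rw [← rawTree_eval_out]
  exact RawTree.subsingleton_eval G φ hφ _

end HTree

end LambdaGraph

/-! ### Minimality of the theories of the completion -/

namespace LambdaGraph

namespace GraphModel

/-- The case of `image_interp_subset` in which every point has exactly one value. It serves to
compare a model with its copy in another universe. -/
theorem mem_interp_of_hom (P : GraphModel.{v}) (G : GraphModel.{u}) (j : P.carrier ↪ G.carrier)
    (hj : ∀ a α, j (P.c a α) = G.c (a.map j) (j α)) (M : LamTerm) {σ : ℕ → Set P.carrier}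
    {ρ : ℕ → Set G.carrier} (h : ∀ x, ∀ t ∈ σ x, j t ∈ ρ x) {t : P.carrier}
    (ht : t ∈ P.interp M σ) : j t ∈ G.interp M ρ := by
  have hu : ∀ a : Finset P.carrier, ((a.map j : Finset G.carrier) : Set G.carrier) =
      ⋃ t ∈ a, {j t} := fun a => by ext; simp [eq_comm]
  refine image_interp_subset P G (fun t => {j t}) (fun t => Set.finite_singleton _) ?_ ?_ M
    (fun x t ht => by simpa using h x t ht) ht rfl
  · rintro a α b _ rfl hb
    rw [← hu, Finset.coe_inj] at hb
    rw [hb, Set.mem_singleton_iff, hj]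
  · rintro a α _ rfl
    exact ⟨a.map j, j α, rfl, hu a, hj a α⟩

/-- A copy of a graph model in a higher universe. -/
def ulift (G : GraphModel.{v}) : GraphModel.{max u v} where
  carrier := ULift.{u} G.carrier
  infinite := Equiv.ulift.infinite_iff.2 G.infinite
  c a α := ⟨G.c (a.map Equiv.ulift.toEmbedding) α.down⟩
  inj a α b β h := by
    obtain ⟨h₁, h₂⟩ := G.inj _ _ _ _ (ULift.up_injective h)
    exact ⟨Finset.map_injective _ h₁, ULift.down_injective h₂⟩

theorem mem_interp_ulift (G : GraphModel.{v}) (M : LamTerm) (σ : ℕ → Set (ULift.{u} G.carrier))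
    (t : ULift.{u} G.carrier) :
    t ∈ (ulift.{u} G).interp M σ ↔ t.down ∈ G.interp M fun x => ULift.up ⁻¹' σ x := by
  constructor
  · intro h
    exact mem_interp_of_hom (ulift.{u} G) G Equiv.ulift.toEmbedding (fun _ _ => rfl) M
      (fun _ _ ht => ht) h
  · intro h
    refine mem_interp_of_hom G (ulift.{u} G) Equiv.ulift.symm.toEmbedding (fun a α => ?_) M
      (fun _ _ ht => ht) h
    change ULift.up _ = ULift.up (G.c ((a.map _).map _) α)
    rw [Finset.map_map]
    congr
    ext; simp

theorem interp_ulift_subset (G : GraphModel.{v}) (M N : LamTerm) :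
    (∀ σ, (ulift.{u} G).interp M σ ⊆ (ulift.{u} G).interp N σ) ↔
      ∀ ρ, G.interp M ρ ⊆ G.interp N ρ := by
  constructor
  · intro h ρ α hα
    exact (mem_interp_ulift G N (fun x => ULift.down ⁻¹' ρ x) ⟨α⟩).1
      (h _ ((mem_interp_ulift G M (fun x => ULift.down ⁻¹' ρ x) ⟨α⟩).2 hα))
  · intro h σ t ht
    exact (mem_interp_ulift G N σ t).2 (h _ ((mem_interp_ulift G M σ t).1 ht))

theorem ordTheory_ulift (G : GraphModel.{v}) : (ulift.{u} G).ordTheory = G.ordTheory :=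
  Set.ext fun p => interp_ulift_subset G p.1 p.2

theorem mem_eqTheory_iff (G : GraphModel.{v}) {p : LamTerm × LamTerm} :
    p ∈ G.eqTheory ↔ p ∈ G.ordTheory ∧ p.swap ∈ G.ordTheory :=
  ⟨fun h => ⟨fun ρ => (h ρ).le, fun ρ => (h ρ).ge⟩,
    fun h ρ => Set.Subset.antisymm (h.1 ρ) (h.2 ρ)⟩

theorem eqTheory_ulift (G : GraphModel.{v}) : (ulift.{u} G).eqTheory = G.eqTheory :=
  Set.ext fun p => by rw [mem_eqTheory_iff, mem_eqTheory_iff, ordTheory_ulift]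

end GraphModel

namespace PartialPair

variable (A : PartialPair.{v})

theorem atomGraph_functional {s : Finset (HTree A.carrier)} {x : HTree A.carrier}
    {γ δ : A.carrier} (h : A.atomGraph s x γ) (h' : A.atomGraph s x δ) : γ = δ := by
  obtain ⟨a, α, hg, rfl, rfl⟩ := h
  obtain ⟨b, β, hg', hs, hx⟩ := h'
  obtain rfl := Finset.map_injective _ hs
  obtain rfl := HTree.atom.injective hx
  exact A.functional _ _ _ _ hg hg'

theorem completionFun_of_atomGraph {s : Finset A.Completion} {x : A.Completion} {γ : A.carrier}
    (h : A.atomGraph (s.map (Function.Embedding.subtype _)) x.1 γ) :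
    (A.completionFun s x).1 = HTree.atom γ := by
  obtain ⟨δ, hδ, e⟩ := A.completionFun_of_dom ⟨γ, h⟩
  rw [e, A.atomGraph_functional h hδ]

/-- On newly formed pairs this is the recursion of the evaluation; only on the domain of the given
partial function is compatibility an assumption, `hφ`. Evaluation thereby meets the requirements of
`image_interp_subset`. -/
theorem mem_eval_completionFun (G : GraphModel.{u}) (φ : A.carrier → Set G.carrier)
    (hφ : ∀ a α γ, A.graph a α γ → ∀ z, z ∈ φ γ ↔ ∃ b : Finset G.carrier, ∃ β ∈ φ α,
      (b : Set G.carrier) = (⋃ t ∈ a, φ t) ∧ z = G.c b β)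
    (s : Finset A.Completion) (x : A.Completion) (z : G.carrier) :
    z ∈ HTree.eval G φ (A.completionFun s x).1 ↔ ∃ b : Finset G.carrier,
      ∃ β ∈ HTree.eval G φ x.1, (b : Set G.carrier) = (⋃ t ∈ s, HTree.eval G φ t.1) ∧
        z = G.c b β := by
  have hs : (⋃ t ∈ s, HTree.eval G φ t.1) =
      ⋃ t ∈ s.map (Function.Embedding.subtype _), HTree.eval G φ t := by
    simp only [Finset.mem_map, Set.iUnion_exists, Set.biUnion_and', Set.iUnion_iUnion_eq_right]
    rfl
  rw [hs]
  by_cases h : ∃ γ, A.atomGraph (s.map (Function.Embedding.subtype _)) x.1 γ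
  · obtain ⟨γ, hγ⟩ := h
    rw [A.completionFun_of_atomGraph hγ]
    obtain ⟨a, α, hg, hsa, hx⟩ := hγ
    have ha : (⋃ t ∈ a.map HTree.atom, HTree.eval G φ t) = ⋃ t ∈ a, φ t := by
      ext; simp [HTree.eval_atom]
    rw [hsa, hx, ha]
    exact hφ a α γ hg z
  · rw [A.completionFun_of_not_dom h, HTree.mem_eval_pair]

end PartialPair

open Classical in
/-- The finite partial pair that is induced by a graph model on a finite set of its elements, with
these elements renamed to natural numbers. -/
noncomputable def GraphModel.finPartialPair (G : GraphModel.{u}) (F : Finset G.carrier) (f : G.carrier → ℕ)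
    (hf : Set.InjOn f F) : FinPartialPair where
  carrier := F.image f
  graph := {q ∈ F.powerset ×ˢ F | G.c q.1 q.2 ∈ F}.image
    fun q => ((q.1.image f, f q.2), f (G.c q.1 q.2))
  closed := by
    intro a α β h
    simp only [Finset.mem_image, Finset.mem_filter, Finset.mem_product, Finset.mem_powerset] at h
    obtain ⟨⟨b, γ⟩, ⟨⟨hb, hγ⟩, hc⟩, e⟩ := h
    obtain ⟨⟨rfl, rfl⟩, rfl⟩ := e
    exact ⟨Finset.image_mono _ hb, Finset.mem_image_of_mem _ hγ, Finset.mem_image_of_mem _ hc⟩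
  functional := by
    intro a α β β' h h'
    simp only [Finset.mem_image, Finset.mem_filter, Finset.mem_product, Finset.mem_powerset]
      at h h'
    obtain ⟨⟨b, γ⟩, ⟨⟨hb, hγ⟩, hc⟩, e⟩ := h
    obtain ⟨⟨b', γ'⟩, ⟨⟨hb', hγ'⟩, hc'⟩, e'⟩ := h'
    simp only [Prod.mk.injEq] at e e' hb hγ hc hb' hγ' hc'
    have hbb : b = b' := Finset.coe_injective ((hf.image_eq_image_iff hb hb').1
      (by rw [← Finset.coe_image, ← Finset.coe_image, e.1.1, e'.1.1]))
    have hγγ : γ = γ' := hf hγ hγ' (e.1.2.trans e'.1.2.symm)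
    rw [← e.2, ← e'.2, hbb, hγγ]
  inj := by
    intro a α a' α' β h h'
    simp only [Finset.mem_image, Finset.mem_filter, Finset.mem_product, Finset.mem_powerset]
      at h h'
    obtain ⟨⟨b, γ⟩, ⟨⟨hb, hγ⟩, hc⟩, e⟩ := h
    obtain ⟨⟨b', γ'⟩, ⟨⟨hb', hγ'⟩, hc'⟩, e'⟩ := h'
    simp only [Prod.mk.injEq] at e e' hb hγ hc hb' hγ' hc'
    obtain ⟨rfl, rfl⟩ := G.inj _ _ _ _ (hf hc hc' (e.2.trans e'.2.symm))
    exact ⟨e.1.1.symm.trans e'.1.1, e.1.2.symm.trans e'.1.2⟩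

namespace EffectiveEnumeration

variable (N : EffectiveEnumeration)

/-- The index of the finite partial pair to which an element of the disjoint union belongs. -/
def idx (q : N.union.carrier) : ℕ := Sigma.fst q

/-- The number that underlies an element of the disjoint union. -/
def val (q : N.union.carrier) : ℕ := (Sigma.snd q).1

variable {N}

theorem val_mem (q : N.union.carrier) : N.val q ∈ (N.pair (N.idx q)).carrier := (Sigma.snd q).2

theorem union_ext {q r : N.union.carrier} (h₁ : N.idx q = N.idx r) (h₂ : N.val q = N.val r) :
    q = r := by
  obtain ⟨k, n, hn⟩ := q
  obtain ⟨l, m, hm⟩ := r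
  obtain rfl : k = l := h₁
  obtain rfl : n = m := h₂
  rfl

theorem exists_idx_val {k n : ℕ} (h : n ∈ (N.pair k).carrier) :
    ∃ q, N.idx q = k ∧ N.val q = n :=
  ⟨⟨k, ⟨n, h⟩⟩, rfl, rfl⟩

/-- Describes the graph by indices and underlying numbers, which avoids transport between the
carriers of different components. -/
theorem union_graph_iff {a : Finset N.union.carrier} {α γ : N.union.carrier} :
    N.union.graph a α γ ↔ N.idx γ = N.idx α ∧
      ∃ b, ((b, N.val α), N.val γ) ∈ (N.pair (N.idx α)).graph ∧
        ∀ q, q ∈ a ↔ N.idx q = N.idx α ∧ N.val q ∈ b := by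
  constructor
  · rintro ⟨i, b, x, y, h, rfl, rfl, rfl⟩
    refine ⟨rfl, _, h, fun q => ?_⟩
    refine Finset.mem_map.trans ⟨?_, ?_⟩
    · rintro ⟨z, hz, rfl⟩
      exact ⟨rfl, Finset.mem_map.2 ⟨z, hz, rfl⟩⟩
    · rintro ⟨hq, hb⟩
      obtain ⟨z, hz, hzq⟩ := Finset.mem_map.1 hb
      exact ⟨z, hz, union_ext hq.symm hzq⟩
  · obtain ⟨k, x⟩ := α
    obtain ⟨l, y⟩ := γ
    rintro ⟨hl, b, hb, hab⟩
    obtain rfl : l = k := hl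
    have hbc := ((N.pair l).closed _ _ _ hb).1
    refine ⟨l, b.subtype _, x, y, ?_, ?_, rfl, rfl⟩
    · change ((_, _), _) ∈ (N.pair l).graph
      rw [Finset.subtype_map_of_mem (fun x hx => hbc hx)]
      exact hb
    · ext q
      refine (hab q).trans (Iff.trans ⟨?_, ?_⟩ Finset.mem_map.symm)
      · rintro ⟨hq, hqb⟩
        exact ⟨⟨N.val q, hbc hqb⟩, Finset.mem_subtype.2 hqb, union_ext hq.symm rfl⟩
      · rintro ⟨z, hz, rfl⟩
        exact ⟨rfl, Finset.mem_subtype.1 hz⟩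

variable (N)

/-- The atoms of the completion. -/
def atom (q : N.union.carrier) : N.model.carrier := ⟨HTree.atom q, 0, Set.mem_range_self _⟩

variable {N} in
theorem c_eq_atom {b : Finset N.model.carrier} {a : Finset N.union.carrier}
    {α γ : N.union.carrier} (h : N.union.graph a α γ) (hb : (b : Set _) = N.atom '' a) :
    N.model.c b (N.atom α) = N.atom γ := by
  refine Subtype.ext (N.union.completionFun_of_atomGraph ⟨a, α, h, ?_, rfl⟩)
  ext t
  have hb' : ∀ s, s ∈ b ↔ ∃ q ∈ a, N.atom q = s := fun s => by
    rw [← Finset.mem_coe, hb]; rfl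
  refine Finset.mem_map.trans (Iff.trans ⟨?_, ?_⟩ Finset.mem_map.symm)
  · rintro ⟨s, hs, rfl⟩
    obtain ⟨q, hq, rfl⟩ := (hb' s).1 hs
    exact ⟨q, hq, rfl⟩
  · rintro ⟨q, hq, rfl⟩
    exact ⟨N.atom q, (hb' _).2 ⟨q, hq, rfl⟩, rfl⟩

/-- A round trip from `G` to the completion and back, through a single component `k` that copies a
finite witness `F` in `G`. -/
theorem ordTheory_subset (G : GraphModel.{u}) : N.model.ordTheory ⊆ G.ordTheory := by
  classical
  rintro ⟨M, L⟩ hML ρ α hα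
  obtain ⟨F', hF', hαF, hF⟩ := GraphModel.exists_finite_witness.{u, 0} G M hα
  obtain ⟨F, rfl⟩ := hF'.exists_finset_coe
  obtain ⟨f, hf⟩ := Set.countable_iff_exists_injOn.1 hF'.countable
  obtain ⟨k, hk⟩ := N.surjective (G.finPartialPair F f hf)
  have hgraph : (N.pair k).graph = (G.finPartialPair F f hf).graph := by rw [hk]
  -- `q g` is the copy of `g` in component `k`; outside `F` its value is arbitrary and plays no
  -- role.
  have hq : ∀ g, ∃ q, g ∈ F → N.idx q = k ∧ N.val q = f g := by
    intro g
    by_cases hg : g ∈ F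
    · obtain ⟨q, hq⟩ := N.exists_idx_val (k := k) (n := f g)
        (by rw [hk]; exact Finset.mem_image_of_mem _ hg)
      exact ⟨q, fun _ => hq⟩
    · exact ⟨Classical.arbitrary _, fun h => absurd h hg⟩
  choose q hq using hq
  -- The inverse of `q` on component `k`, and empty on the atoms of all other components.
  let φ : N.union.carrier → Set G.carrier := fun r => {g | g ∈ F ∧ N.idx r = k ∧ f g = N.val r}
  have hφsub : ∀ r, (φ r).Subsingleton := fun r g hg g' hg' =>
    hf hg.1 hg'.1 (hg.2.2.trans hg'.2.2.symm)
  have hφ : ∀ a α γ, N.union.graph a α γ → ∀ z, z ∈ φ γ ↔ ∃ b : Finset G.carrier, ∃ β ∈ φ α,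
      (b : Set G.carrier) = (⋃ t ∈ a, φ t) ∧ z = G.c b β := by
    intro a x y hg z
    obtain ⟨hxy, b, hb, hab⟩ := union_graph_iff.1 hg
    -- In component `k` the entries are those of `G` on `F`. In another component both sides are
    -- empty, as argument and value share their index.
    by_cases hi : N.idx x = k
    · rw [hi, hgraph] at hb
      simp only [GraphModel.finPartialPair, Finset.mem_image, Finset.mem_filter,
        Finset.mem_product, Finset.mem_powerset, Prod.mk.injEq, Prod.exists] at hb
      obtain ⟨a', β, ⟨⟨ha', hβ⟩, hc⟩, ⟨rfl, hβx⟩, hcy⟩ := hb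
      have hu : (⋃ t ∈ a, φ t) = (a' : Set G.carrier) := by
        ext g
        simp only [Set.mem_iUnion, exists_prop, Finset.mem_coe]
        constructor
        · rintro ⟨r, hr, hgF, -, hgr⟩
          obtain ⟨g', hg', hgg'⟩ := Finset.mem_image.1 ((hab r).1 hr).2
          rwa [hf hgF (ha' hg') (hgr.trans hgg'.symm)]
        · intro hga
          obtain ⟨h₁, h₂⟩ := hq g (ha' hga)
          exact ⟨q g, (hab _).2 ⟨h₁.trans hi.symm, h₂ ▸ Finset.mem_image_of_mem _ hga⟩,
            ha' hga, h₁, h₂.symm⟩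
      rw [hu]
      constructor
      · intro hz
        exact ⟨a', β, ⟨hβ, hi, hβx⟩, rfl, hφsub _ hz ⟨hc, hxy.trans hi, hcy⟩⟩
      · rintro ⟨b', β', hβ', hb', rfl⟩
        obtain rfl := Finset.coe_injective hb'
        obtain rfl := hf hβ'.1 hβ (hβ'.2.2.trans hβx.symm)
        exact ⟨hc, hxy.trans hi, hcy⟩
    · constructor
      · exact fun hz => absurd (hxy.symm.trans hz.2.1) hi
      · rintro ⟨_, β, hβ, -⟩
        exact absurd hβ.2.1 hi
  have hθ := N.union.mem_eval_completionFun G φ hφ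
  have hθq : ∀ g ∈ F, HTree.eval G φ (N.atom (q g)).1 = {g} := fun g hg =>
    (hφsub (q g)).eq_singleton_of_mem ⟨hg, (hq g hg).1, (hq g hg).2.symm⟩
  -- The environment holds copies of points of `F ∩ ρ x` only, so that evaluation brings it back
  -- inside `ρ`.
  have hmem : N.atom (q α) ∈ N.model.interp M fun x => (fun g => N.atom (q g)) '' (F ∩ ρ x) := by
    refine hF N.model (fun g => N.atom (q g)) _ (fun a β b ha hβ hc hb => ?_) fun x => subset_rfl
    have hsub : ∀ g ∈ a, g ∈ F := fun g hg => ha hg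
    refine (c_eq_atom (a := a.image q) (union_graph_iff.2 ⟨?_, a.image f, ?_, fun r => ?_⟩)
      ?_).symm
    · rw [(hq _ hc).1, (hq _ hβ).1]
    · rw [(hq _ hβ).1, (hq _ hβ).2, (hq _ hc).2, hgraph]
      simp only [GraphModel.finPartialPair, Finset.mem_image, Finset.mem_filter,
        Finset.mem_product, Finset.mem_powerset, Prod.mk.injEq, Prod.exists]
      exact ⟨a, β, ⟨⟨ha, hβ⟩, hc⟩, ⟨rfl, rfl⟩, rfl⟩
    · rw [Finset.mem_image, Finset.mem_image, (hq _ hβ).1]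
      constructor
      · rintro ⟨g, hg, rfl⟩
        exact ⟨(hq g (hsub g hg)).1, g, hg, (hq g (hsub g hg)).2.symm⟩
      · rintro ⟨hr, g, hg, hgr⟩
        exact ⟨g, hg, union_ext ((hq g (hsub g hg)).1.trans hr.symm)
          ((hq g (hsub g hg)).2.trans hgr)⟩
    · rw [hb, Finset.coe_image, Set.image_image]
  refine GraphModel.image_interp_subset N.model G (fun t => HTree.eval G φ t.1)
    (fun t => (HTree.subsingleton_eval G φ hφsub t.1).finite)
    (fun a α b β hβ hb => (hθ a α _).2 ⟨b, β, hβ, hb, rfl⟩)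
    (fun a α γ hγ => (hθ a α γ).1 hγ) L ?_ (hML _ hmem) ?_
  · rintro x _ ⟨g, ⟨hgF, hgρ⟩, rfl⟩ z hz
    rw [hθq g hgF] at hz
    rwa [hz]
  · rw [hθq α hαF]
    rfl

theorem isLeast_ordTheory : IsLeast orderGraphTheories.{u} N.model.ordTheory := by
  -- The completion lives in the lowest universe; its copy in universe `u` has the same theory.
  refine ⟨⟨GraphModel.ulift.{u} N.model, GraphModel.ordTheory_ulift _⟩, ?_⟩
  rintro _ ⟨G, rfl⟩
  exact N.ordTheory_subset G

theorem isLeast_eqTheory : IsLeast eqGraphTheories.{u} N.model.eqTheory := by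
  refine ⟨⟨GraphModel.ulift.{u} N.model, GraphModel.eqTheory_ulift _⟩, ?_⟩
  rintro _ ⟨G, rfl⟩ p hp
  rw [GraphModel.mem_eqTheory_iff] at hp ⊢
  exact ⟨N.ordTheory_subset G hp.1, N.ordTheory_subset G hp.2⟩

end EffectiveEnumeration

end LambdaGraph

namespace LambdaGraph

/-! ### Function spaces of complete domains -/

section FunctionSpace

variable {D : Type u} {E : Type v} [PartialOrder D] [PartialOrder E]

/-- The pointwise supremum is continuous because suprema commute with suprema. -/
theorem exists_isLUB_scottMap (hE : ∀ s : Set E, ∃ a, IsLUB s a) (S : Set (ScottMap D E)) :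
    ∃ f : ScottMap D E, IsLUB S f ∧ ∀ x, IsLUB ((fun g => g.1 x) '' S) (f.1 x) := by
  choose f hf using fun x => hE ((fun g : ScottMap D E => g.1 x) '' S)
  have hcont : ScottContinuous f := by
    intro t ht hd a ha
    refine ⟨?_, fun B hB => (hf a).2 ?_⟩
    · rintro _ ⟨z, hz, rfl⟩
      refine (hf z).2 ?_
      rintro _ ⟨g, hg, rfl⟩
      exact (g.2.monotone (ha.1 hz)).trans ((hf a).1 ⟨g, hg, rfl⟩)
    · rintro _ ⟨g, hg, rfl⟩
      refine (g.2 ht hd ha).2 ?_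
      rintro _ ⟨z, hz, rfl⟩
      exact ((hf z).1 ⟨g, hg, rfl⟩).trans (hB ⟨z, hz, rfl⟩)
  refine ⟨⟨f, hcont⟩, ⟨fun g hg x => (hf x).1 ⟨g, hg, rfl⟩, fun h hh x => (hf x).2 ?_⟩, hf⟩
  rintro _ ⟨g, hg, rfl⟩
  exact hh hg x

theorem isLUB_apply (hE : ∀ s : Set E, ∃ a, IsLUB s a) {S : Set (ScottMap D E)}
    {f : ScottMap D E} (hf : IsLUB S f) (x : D) : IsLUB ((fun g => g.1 x) '' S) (f.1 x) := by
  obtain ⟨g, hg, hgx⟩ := exists_isLUB_scottMap hE S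
  rw [hf.unique hg]
  exact hgx x

variable [OrderBot E]

open Classical in
theorem scottContinuous_step {k : D} (hk : IsCompactElement k) (y : E) :
    ScottContinuous fun x => if k ≤ x then y else ⊥ := by
  intro s hs hd a ha
  refine ⟨?_, fun B hB => ?_⟩
  · rintro _ ⟨z, hz, rfl⟩
    by_cases hkz : k ≤ z
    · simp [hkz, hkz.trans (ha.1 hz)]
    · simp [hkz]
  · by_cases hka : k ≤ a
    · obtain ⟨z, hz, hkz⟩ := hk s a hs hd ha hka
      have := hB ⟨z, hz, rfl⟩
      simpa [hka, hkz] using this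
    · simp [hka]

/-- A continuous map satisfies the constraint of `(i, j)` exactly when it lies above the step
function from `d i` to `e j`, which is continuous as `d i` is compact. The supremum of these step
functions is the least solution. -/
theorem exists_isLeast_steps (hE : ∀ s : Set E, ∃ a, IsLUB s a) {d : ℕ → D}
    (hd : ∀ i, IsCompactElement (d i)) (e : ℕ → E) (L : List (ℕ × ℕ)) :
    ∃ f : ScottMap D E, IsLeast {g : ScottMap D E | ∀ p ∈ L, e p.2 ≤ g.1 (d p.1)} f ∧
      ∀ x, IsLUB {y | ∃ p ∈ L, d p.1 ≤ x ∧ e p.2 = y} (f.1 x) := by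
  classical
  obtain ⟨f, hf, hfx⟩ := exists_isLUB_scottMap hE
    {g : ScottMap D E | ∃ p ∈ L, g = ⟨_, scottContinuous_step (hd p.1) (e p.2)⟩}
  refine ⟨f, ⟨fun p hp => ?_, fun g hg => hf.2 ?_⟩, fun x => ⟨?_, fun B hB => (hfx x).2 ?_⟩⟩
  · have := hf.1 ⟨p, hp, rfl⟩ (d p.1)
    simpa using this
  · rintro _ ⟨p, hp, rfl⟩ x
    by_cases h : d p.1 ≤ x
    · simpa [h] using (hg p hp).trans (g.2.monotone h)
    · simp [h]
  · rintro _ ⟨p, hp, h, rfl⟩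
    have := hf.1 ⟨p, hp, rfl⟩ x
    simpa [h] using this
  · rintro _ ⟨_, ⟨p, hp, rfl⟩, rfl⟩
    by_cases h : d p.1 ≤ x
    · simpa [h] using hB ⟨p, hp, h, rfl⟩
    · simp [h]

variable (hE : ∀ s : Set E, ∃ a, IsLUB s a) {d : ℕ → D} (hd : ∀ i, IsCompactElement (d i))
  (e : ℕ → E) (n : ℕ)

include hE hd

/-- As all suprema exist in `E`, every list of step functions is bounded and the default `⊥` in
`funNum` never occurs. -/
theorem isLeast_funNum : IsLeast {g : ScottMap D E |
    ∀ p ∈ Denumerable.ofNat (List (ℕ × ℕ)) n, e p.2 ≤ g.1 (d p.1)} (funNum d e n) := by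
  obtain ⟨f, hf, -⟩ := exists_isLeast_steps hE hd e (Denumerable.ofNat (List (ℕ × ℕ)) n)
  have h : ∃ f : ScottMap D E, IsLeast {g : ScottMap D E |
      ∀ p ∈ Denumerable.ofNat (List (ℕ × ℕ)) n, e p.2 ≤ g.1 (d p.1)} f := ⟨f, hf⟩
  rw [funNum, dif_pos h]
  exact h.choose_spec

/-- Reduces comparison with a compact map to finitely many comparisons at compact arguments; applied
twice, it handles the function spaces of higher type. -/
theorem funNum_le_iff {f : ScottMap D E} : funNum d e n ≤ f ↔
    ∀ p ∈ Denumerable.ofNat (List (ℕ × ℕ)) n, e p.2 ≤ f.1 (d p.1) :=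
  ⟨fun h p hp => ((isLeast_funNum hE hd e n).1 p hp).trans (h _),
    fun h => (isLeast_funNum hE hd e n).2 h⟩

theorem isLUB_funNum_apply (x : D) : IsLUB
    {y | ∃ p ∈ Denumerable.ofNat (List (ℕ × ℕ)) n, d p.1 ≤ x ∧ e p.2 = y}
    ((funNum d e n).1 x) := by
  obtain ⟨f, hf, hfx⟩ := exists_isLeast_steps hE hd e (Denumerable.ofNat (List (ℕ × ℕ)) n)
  rw [(isLeast_funNum hE hd e n).unique hf]
  exact hfx x

/-- Each of the finitely many constraints is met by some member of the directed set, and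
directedness merges these members. Step functions on `[D → D]`, needed for `λ`, rest on this. -/
theorem isCompactElement_funNum (he : ∀ i, IsCompactElement (e i)) :
    IsCompactElement (funNum d e n) := by
  intro S f hS hdir hf hle
  rw [funNum_le_iff hE hd] at hle
  simp only [funNum_le_iff hE hd]
  generalize Denumerable.ofNat (List (ℕ × ℕ)) n = L at hle
  induction L with
  | nil => exact hS.imp fun g hg => ⟨hg, by simp⟩
  | cons p L ih =>
    obtain ⟨g, hg, hgL⟩ := ih fun q hq => hle q (List.mem_cons_of_mem _ hq)
    obtain ⟨_, ⟨g', hg', rfl⟩, hgp⟩ := he p.2 _ _ (hS.image _)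
      (by
        rintro _ ⟨g₁, h₁, rfl⟩ _ ⟨g₂, h₂, rfl⟩
        obtain ⟨g₃, h₃, h₁₃, h₂₃⟩ := hdir g₁ h₁ g₂ h₂
        exact ⟨_, ⟨g₃, h₃, rfl⟩, h₁₃ _, h₂₃ _⟩)
      (isLUB_apply hE hf (d p.1)) (hle p List.mem_cons_self)
    obtain ⟨k, hk, hgk, hgk'⟩ := hdir g hg g' hg'
    refine ⟨k, hk, fun q hq => ?_⟩
    rcases List.mem_cons.1 hq with rfl | hq
    · exact hgp.trans (hgk' _)
    · exact (hgL q hq).trans (hgk _)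

end FunctionSpace

/-! ### Power sets as Scott domains -/

theorem isCompactElement_set_iff {X : Type u} {s : Set X} : IsCompactElement s ↔ s.Finite := by
  constructor
  · intro h
    obtain ⟨t, ⟨ht, -⟩, hst⟩ := h {t | t.Finite ∧ t ⊆ s} s ⟨∅, by simp⟩
      (fun Z hZ W hW => ⟨Z ∪ W, ⟨hZ.1.union hW.1, Set.union_subset hZ.2 hW.2⟩,
        Set.subset_union_left, Set.subset_union_right⟩)
      ⟨fun Z hZ => hZ.2, fun B hB y hy =>
        hB (a := {y}) ⟨Set.finite_singleton y, by simpa using hy⟩ rfl⟩ le_rfl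
    exact ht.subset hst
  · intro hs S t hS hdir ht hst
    obtain rfl := ht.unique (isLUB_sSup S)
    obtain ⟨s, rfl⟩ := hs.exists_finset_coe
    exact DirectedOn.exists_mem_subset_of_finset_subset_biUnion (f := id)
      (s := s) hS (by simpa [DirectedOn] using hdir) (by simpa [Set.sUnion_eq_biUnion] using hst)

theorem isScottDomain_set (X : Type u) : IsScottDomain (Set X) where
  directed_sup s _ _ := ⟨_, isLUB_sSup s⟩
  bounded_sup s _ := ⟨_, isLUB_sSup s⟩
  directed_compact a := by
    simp only [isCompactElement_set_iff]
    exact fun Z hZ W hW => ⟨Z ∪ W, ⟨hZ.1.union hW.1, Set.union_subset hZ.2 hW.2⟩,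
        Set.subset_union_left, Set.subset_union_right⟩
  algebraic a := by
    simp only [isCompactElement_set_iff]
    exact ⟨fun Z hZ => hZ.2, fun B hB y hy =>
      hB (a := {y}) ⟨Set.finite_singleton y, by simpa using hy⟩ rfl⟩

end LambdaGraph

/-! ### Effectivity of a graph model with a computable coding -/

namespace LambdaGraph

namespace GraphModel

/-- The finite set that is coded by a binary number, relative to a coding of the elements. -/
def codedSet {X : Type u} (code : X → ℕ) (n : ℕ) : Set X := {e | n.testBit (code e) = true}

section

variable {X : Type u} {code : X ↪ ℕ}

theorem finite_codedSet (n : ℕ) : (codedSet code n).Finite :=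
  Set.Finite.preimage code.injective.injOn
    ((Set.finite_lt_nat n).subset fun _ (hi : n.testBit _ = true) => lt_of_testBit hi)

theorem codedSet_setCode (a : Finset X) : codedSet code (setCode (a.map code)) = a := by
  ext e
  simp only [codedSet, Set.mem_ofPred_eq, testBit_setCode, Finset.mem_map', Finset.mem_coe]

theorem codedSet_two_pow (e : X) : codedSet code (2 ^ code e) = {e} := by
  rw [← setCode_singleton, ← Finset.map_singleton, codedSet_setCode, Finset.coe_singleton]

/-- Digits at places that are not codes are ignored. Every number thus codes a finite set, but not
uniquely, and membership in the range of `code` has to be tested. -/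
theorem codedSet_subset_iff {n : ℕ} {s : Set X} : codedSet code n ⊆ s ↔
    ∀ y, n.testBit y = true → y ∈ Set.range code → ∃ e ∈ s, code e = y :=
  ⟨fun h _ hy ⟨e, he⟩ => ⟨e, h (by rwa [← he] at hy), he⟩, fun h e he => by
    obtain ⟨e', he', h'⟩ := h _ he ⟨e, rfl⟩
    rwa [← code.injective h']⟩

theorem computablePred_codedSet_subset (hv : ComputablePred fun n => n ∈ Set.range code)
    {α : Type*} [Primcodable α] {f g : α → ℕ} (hf : Computable f) (hg : Computable g) :
    ComputablePred fun a => codedSet code (f a) ⊆ codedSet code (g a) := by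
  refine (ComputablePred.forall_testBit (p := fun a y => y ∈ Set.range code →
    (g a).testBit y = true) (.imp (hv.comp .snd) (.testBit (hg.comp .fst) .snd)) hf).of_eq
    fun a => ?_
  rw [codedSet_subset_iff]
  refine forall_congr' fun y => imp_congr_right fun _ => ⟨?_, ?_⟩
  · rintro h ⟨e, rfl⟩
    exact ⟨e, h ⟨e, rfl⟩, rfl⟩
  · rintro h hy
    obtain ⟨e, he, rfl⟩ := h hy
    exact he

theorem isEffectiveDomain_codedSet (hv : ComputablePred fun n => n ∈ Set.range code) :
    IsEffectiveDomain (codedSet code) where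
  scott := isScottDomain_set X
  range_eq := by
    ext s
    simp only [isCompactElement_set_iff, Set.mem_range, Set.mem_ofPred_eq]
    constructor
    · rintro ⟨n, rfl⟩
      exact finite_codedSet n
    · intro hs
      obtain ⟨a, rfl⟩ := hs.exists_finset_coe
      exact ⟨_, codedSet_setCode a⟩
  bounded_decidable := by
    refine (PrimrecPred.computablePred (PrimrecPred.of_eq (p := fun _ => True)
      (Primrec.primrecPred (Primrec.const true)) fun p => ?_))
    exact iff_of_true trivial ⟨Set.univ, fun _ _ => Set.subset_univ _⟩
  join_decidable := by
    have h₁ : ComputablePred fun p : ℕ × ℕ × ℕ => codedSet code p.2.1 ⊆ codedSet code p.1 :=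
      computablePred_codedSet_subset hv (Computable.fst.comp .snd) .fst
    have h₂ : ComputablePred fun p : ℕ × ℕ × ℕ => codedSet code p.2.2 ⊆ codedSet code p.1 :=
      computablePred_codedSet_subset hv (Computable.snd.comp .snd) .fst
    have h₃ : ComputablePred fun p : ℕ × ℕ × ℕ => ∀ y, p.1.testBit y = true → y ∈ Set.range code →
        p.2.1.testBit y = true ∨ p.2.2.testBit y = true :=
      .forall_testBit (p := fun (p : ℕ × ℕ × ℕ) y => y ∈ Set.range code →
        p.2.1.testBit y = true ∨ p.2.2.testBit y = true)
        ((hv.comp .snd).imp ((ComputablePred.testBit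
          (Computable.fst.comp (Computable.snd.comp .fst)) .snd).or (ComputablePred.testBit
          (Computable.snd.comp (Computable.snd.comp .fst)) .snd))) .fst
    refine (h₁.and (h₂.and h₃)).of_eq fun p => ?_
    have hu : IsLUB {codedSet code p.2.1, codedSet code p.2.2}
        (codedSet code p.2.1 ∪ codedSet code p.2.2) := isLUB_pair
    have key : (∀ y, p.1.testBit y = true → y ∈ Set.range code →
        p.2.1.testBit y = true ∨ p.2.2.testBit y = true) ↔
        codedSet code p.1 ⊆ codedSet code p.2.1 ∪ codedSet code p.2.2 :=
      ⟨fun h e he => h _ he ⟨e, rfl⟩, by rintro h _ hy ⟨e, rfl⟩; exact h hy⟩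
    rw [key]
    constructor
    · rintro ⟨k₁, k₂, k₃⟩
      rwa [Set.Subset.antisymm k₃ (Set.union_subset k₁ k₂)]
    · intro h
      rw [h.unique hu]
      exact ⟨Set.subset_union_left, Set.subset_union_right, subset_rfl⟩

end

variable (G : GraphModel.{u})

/-- By injectivity of `c`, an element `c(a, α)` of `X` determines `α`, so each element of `X` yields
at most one element of the result. -/
theorem finite_appSet {X Y : Set G.carrier} (hX : X.Finite) : (G.appSet X Y).Finite := by
  have h : (G.appSet X Y) ⊆ Prod.snd '' ((fun p : Finset G.carrier × G.carrier =>
      G.c p.1 p.2) ⁻¹' X) := by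
    rintro α ⟨a, -, h⟩
    exact ⟨(a, α), h, rfl⟩
  refine (Set.Finite.image _ (Set.Finite.preimage ?_ hX)).subset h
  rintro ⟨a, α⟩ - ⟨b, β⟩ - hab
  exact Prod.ext_iff.2 (G.inj _ _ _ _ hab)

theorem finite_foldl_app {X : Set G.carrier} (hX : X.Finite) (l : List (Set G.carrier)) :
    (l.foldl (fun x y => (G.reflexive.app.1 x).1 y) X).Finite := by
  induction l generalizing X with
  | nil => exact hX
  | cons Y l ih => exact ih (X := G.appSet X Y) (G.finite_appSet hX)

variable {G} {code : G.carrier ↪ ℕ} (hv : ComputablePred fun n => n ∈ Set.range code)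
  {dec : ℕ → Option (ℕ × ℕ)} (hdec : Computable dec)
  (h₁ : ∀ a α, dec (code (G.c a α)) = some (setCode (a.map code), code α))
  (h₂ : ∀ γ, (∀ a α, γ ≠ G.c a α) → dec (code γ) = none)

include h₁ h₂

theorem exists_eq_c {γ : G.carrier} {q : ℕ × ℕ} (h : dec (code γ) = some q) :
    ∃ a α, γ = G.c a α ∧ q = (setCode (a.map code), code α) := by
  by_cases hγ : ∃ a α, γ = G.c a α
  · obtain ⟨a, α, rfl⟩ := hγ
    rw [h₁, Option.some_inj] at h
    exact ⟨a, α, rfl, h.symm⟩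
  · push Not at hγ
    rw [h₂ γ hγ] at h
    simp at h

/-- The search for a finite set `a` with `c(a, α)` in the first set becomes a search among the
digits `y` of `i`, decoded by `dec`. The default `(0, 0)` is immaterial once `dec y` is known to be
defined. -/
theorem codedSet_subset_appSet_iff (l i k : ℕ) :
    codedSet code l ⊆ G.appSet (codedSet code i) (codedSet code k) ↔
      ∀ x, l.testBit x = true → x ∈ Set.range code → ∃ y, i.testBit y = true ∧
        y ∈ Set.range code ∧ (dec y).isSome = true ∧ ((dec y).getD (0, 0)).2 = x ∧
          codedSet code ((dec y).getD (0, 0)).1 ⊆ codedSet code k := by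
  rw [codedSet_subset_iff]
  refine forall_congr' fun x => imp_congr_right fun _ => imp_congr_right fun _ => ⟨?_, ?_⟩
  · rintro ⟨α, ⟨a, ha, hα⟩, rfl⟩
    refine ⟨_, hα, ⟨_, rfl⟩, ?_⟩
    rw [h₁]
    exact ⟨rfl, rfl, by simpa [codedSet_setCode] using ha⟩
  · rintro ⟨_, hy, ⟨γ, rfl⟩, hs, rfl, hsub⟩
    obtain ⟨q, hq⟩ := Option.isSome_iff_exists.1 hs
    obtain ⟨a, α, rfl, rfl⟩ := exists_eq_c h₁ h₂ hq
    rw [h₁, Option.getD_some, codedSet_setCode] at hsub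
    exact ⟨α, ⟨a, hsub, hy⟩, by rw [h₁]; rfl⟩

/-- An element of `λ(f)` is decoded into `(a, α)`. Writing `α ∈ f(a)` with the code `2 ^ code α` of
`{α}` gives a comparison of compact elements with values of `f` at compact elements. -/
theorem codedSet_subset_lamSet_iff (j : ℕ) (f : Set G.carrier → Set G.carrier) :
    codedSet code j ⊆ G.lamSet f ↔ ∀ y, j.testBit y = true → y ∈ Set.range code →
      (dec y).isSome = true ∧ codedSet code (2 ^ ((dec y).getD (0, 0)).2) ⊆
        f (codedSet code ((dec y).getD (0, 0)).1) := by
  rw [codedSet_subset_iff]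
  refine forall_congr' fun y => imp_congr_right fun _ => ⟨?_, ?_⟩
  · rintro h hy
    obtain ⟨_, ⟨a, α, rfl, hα⟩, rfl⟩ := h hy
    rw [h₁]
    refine ⟨rfl, ?_⟩
    rw [Option.getD_some, codedSet_setCode, codedSet_two_pow]
    simpa using hα
  · rintro h hy
    obtain ⟨hs, hsub⟩ := h hy
    obtain ⟨γ, rfl⟩ := hy
    obtain ⟨q, hq⟩ := Option.isSome_iff_exists.1 hs
    obtain ⟨a, α, rfl, rfl⟩ := exists_eq_c h₁ h₂ hq
    rw [h₁, Option.getD_some, codedSet_setCode, codedSet_two_pow] at hsub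
    exact ⟨_, ⟨a, α, rfl, by simpa using hsub⟩, rfl⟩

include hv hdec

/-- A graph model is effective if its elements can be coded by natural numbers in such a way that
the set of codes is decidable and the inverse of the function of the model is computable. -/
theorem isEffective_of_code : G.IsEffective := by
  have hE : ∀ s : Set (Set G.carrier), ∃ a, IsLUB s a := fun s => ⟨_, isLUB_sSup s⟩
  have hE' : ∀ s : Set (ScottMap (Set G.carrier) (Set G.carrier)), ∃ a, IsLUB s a :=
    fun s => (exists_isLUB_scottMap hE s).imp fun _ h => h.1
  have hd : ∀ i, IsCompactElement (codedSet code i) := fun i =>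
    isCompactElement_set_iff.2 (finite_codedSet i)
  have hfun : ∀ i, IsCompactElement (funNum (codedSet code) (codedSet code) i) := fun i =>
    isCompactElement_funNum hE hd _ i hd
  have hA : Computable fun y => ((dec y).getD (0, 0)).1 :=
    Computable.fst.comp (Computable.option_getD hdec (Computable.const _))
  have hX : Computable fun y => ((dec y).getD (0, 0)).2 :=
    Computable.snd.comp (Computable.option_getD hdec (Computable.const _))
  have hs : ComputablePred fun y => (dec y).isSome = true :=
    ComputablePred.computable_iff.2 ⟨_, Primrec.option_isSome.to_comp.comp hdec, rfl⟩
  have hL : Computable (Denumerable.ofNat (List (ℕ × ℕ))) := Computable.ofNat _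
  refine ⟨codedSet code, ⟨⟨isEffectiveDomain_codedSet hv, ?_, ?_⟩, ?_, ?_⟩⟩
  -- A compact element of `[D → [D → D]]` is a list of pairs `p` whose second component codes a list
  -- of pairs `q`; each `q` demands that the set `q.2` lie in the application of `p.1` to `q.1`.
  -- This is even decidable.
  · have h : ComputablePred fun n => ∀ p ∈ Denumerable.ofNat (List (ℕ × ℕ)) n,
        ∀ q ∈ Denumerable.ofNat (List (ℕ × ℕ)) p.2, ∀ x, q.2.testBit x = true →
          x ∈ Set.range code → ∃ y, p.1.testBit y = true ∧ y ∈ Set.range code ∧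
          (dec y).isSome = true ∧ ((dec y).getD (0, 0)).2 = x ∧
          codedSet code ((dec y).getD (0, 0)).1 ⊆ codedSet code q.1 := by
      refine .forall_mem_list (p := fun (_ : ℕ) (p : ℕ × ℕ) =>
        ∀ q ∈ Denumerable.ofNat (List (ℕ × ℕ)) p.2, ∀ x, q.2.testBit x = true →
          x ∈ Set.range code → ∃ y, p.1.testBit y = true ∧ y ∈ Set.range code ∧
          (dec y).isSome = true ∧ ((dec y).getD (0, 0)).2 = x ∧
          codedSet code ((dec y).getD (0, 0)).1 ⊆ codedSet code q.1) ?_ hL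
      refine .forall_mem_list (p := fun (p : ℕ × ℕ × ℕ) (q : ℕ × ℕ) => ∀ x, q.2.testBit x = true →
          x ∈ Set.range code → ∃ y, p.2.1.testBit y = true ∧ y ∈ Set.range code ∧
          (dec y).isSome = true ∧ ((dec y).getD (0, 0)).2 = x ∧
          codedSet code ((dec y).getD (0, 0)).1 ⊆ codedSet code q.1) ?_
          (hL.comp (Computable.snd.comp .snd))
      refine .forall_testBit (p := fun (r : (ℕ × ℕ × ℕ) × (ℕ × ℕ)) x =>
          x ∈ Set.range code → ∃ y, r.1.2.1.testBit y = true ∧ y ∈ Set.range code ∧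
          (dec y).isSome = true ∧ ((dec y).getD (0, 0)).2 = x ∧
          codedSet code ((dec y).getD (0, 0)).1 ⊆ codedSet code r.2.1) (.imp (hv.comp .snd) ?_)
          (Computable.snd.comp .snd)
      refine .exists_testBit (p := fun (r : ((ℕ × ℕ × ℕ) × (ℕ × ℕ)) × ℕ) y => y ∈ Set.range code ∧
          (dec y).isSome = true ∧ ((dec y).getD (0, 0)).2 = r.2 ∧
          codedSet code ((dec y).getD (0, 0)).1 ⊆ codedSet code r.1.2.1)
          ((hv.comp .snd).and ((hs.comp .snd).and (.and ?_ ?_)))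
          (Computable.fst.comp (Computable.snd.comp (Computable.fst.comp .fst)))
      · exact ComputablePred.eq (hX.comp .snd) (Computable.snd.comp .fst)
      · exact computablePred_codedSet_subset hv (hA.comp .snd)
          (Computable.fst.comp (Computable.snd.comp (Computable.fst.comp .fst)))
    refine (h.of_eq fun n => ?_).to_re
    simp only [funNum_le_iff hE' hd, funNum_le_iff hE hd, ← codedSet_subset_appSet_iff h₁ h₂]
    rfl
  -- Here `p.1` codes a list of step functions. Its value at `a` is the union of the sets `q.2` over
  -- the entries with `q.1` inside `a`, so an element lies in the value iff it lies in one such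
  -- `q.2`.
  · have h : ComputablePred fun n => ∀ p ∈ Denumerable.ofNat (List (ℕ × ℕ)) n,
        ∀ y, p.2.testBit y = true → y ∈ Set.range code → (dec y).isSome = true ∧
          ∃ q ∈ Denumerable.ofNat (List (ℕ × ℕ)) p.1,
            codedSet code q.1 ⊆ codedSet code ((dec y).getD (0, 0)).1 ∧
            codedSet code (2 ^ ((dec y).getD (0, 0)).2) ⊆ codedSet code q.2 := by
      refine .forall_mem_list (p := fun (_ : ℕ) (p : ℕ × ℕ) =>
        ∀ y, p.2.testBit y = true → y ∈ Set.range code → (dec y).isSome = true ∧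
          ∃ q ∈ Denumerable.ofNat (List (ℕ × ℕ)) p.1,
            codedSet code q.1 ⊆ codedSet code ((dec y).getD (0, 0)).1 ∧
            codedSet code (2 ^ ((dec y).getD (0, 0)).2) ⊆ codedSet code q.2) ?_ hL
      refine .forall_testBit (p := fun (r : ℕ × ℕ × ℕ) y =>
          y ∈ Set.range code → (dec y).isSome = true ∧
          ∃ q ∈ Denumerable.ofNat (List (ℕ × ℕ)) r.2.1,
            codedSet code q.1 ⊆ codedSet code ((dec y).getD (0, 0)).1 ∧
            codedSet code (2 ^ ((dec y).getD (0, 0)).2) ⊆ codedSet code q.2)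
          (.imp (hv.comp .snd) ((hs.comp .snd).and ?_)) (Computable.snd.comp .snd)
      refine .exists_mem_list (p := fun (r : (ℕ × ℕ × ℕ) × ℕ) (q : ℕ × ℕ) =>
            codedSet code q.1 ⊆ codedSet code ((dec r.2).getD (0, 0)).1 ∧
            codedSet code (2 ^ ((dec r.2).getD (0, 0)).2) ⊆ codedSet code q.2) (.and ?_ ?_)
          (hL.comp (Computable.fst.comp (Computable.snd.comp .fst)))
      · exact computablePred_codedSet_subset hv (Computable.fst.comp .snd)
          (hA.comp (Computable.snd.comp .fst))
      · exact computablePred_codedSet_subset hv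
          (Primrec.two_pow.to_comp.comp (hX.comp (Computable.snd.comp .fst)))
          (Computable.snd.comp .snd)
    refine (h.of_eq fun n => ?_).to_re
    rw [funNum_le_iff hE hfun]
    refine forall_congr' fun p => imp_congr_right fun _ => ?_
    change _ ↔ codedSet code p.2 ⊆ G.lamSet _
    rw [codedSet_subset_lamSet_iff h₁ h₂]
    refine forall_congr' fun y => imp_congr_right fun _ => imp_congr_right fun hy =>
      and_congr_right fun hy' => ?_
    obtain ⟨γ, rfl⟩ := hy
    obtain ⟨q, hq⟩ := Option.isSome_iff_exists.1 hy'
    obtain ⟨a, α, rfl, rfl⟩ := exists_eq_c h₁ h₂ hq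
    simp only [h₁, Option.getD_some, codedSet_two_pow]
    rw [(isLUB_funNum_apply hE hd _ _ _).unique (isLUB_sSup _)]
    simp only [Set.singleton_subset_iff, Set.sSup_eq_sUnion, Set.mem_sUnion]
    constructor
    · rintro ⟨q, hq, h, h'⟩
      exact ⟨_, ⟨q, hq, h, rfl⟩, h'⟩
    · rintro ⟨_, ⟨q, hq, h, rfl⟩, h'⟩
      exact ⟨q, hq, h, h'⟩
  · intro k hk es _
    -- The result is a finite set, so a fixed number codes it and inclusion in it is decidable.
    have hfin := G.finite_foldl_app (isCompactElement_set_iff.1 hk) es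
    obtain ⟨a, ha⟩ := hfin.exists_finset_coe
    rw [IsDecElement, ← ha, ← codedSet_setCode (code := code) a]
    exact computablePred_codedSet_subset hv .id (Computable.const _)
  · intro f _ hf
    have h : ComputablePred fun n : ℕ => ∀ y, n.testBit y = true → y ∈ Set.range code →
        (dec y).isSome = true ∧ codedSet code (2 ^ ((dec y).getD (0, 0)).2) ⊆
          f.1 (codedSet code ((dec y).getD (0, 0)).1) := by
      refine .forall_testBit (p := fun (_ : ℕ) (y : ℕ) => y ∈ Set.range code →
        (dec y).isSome = true ∧ codedSet code (2 ^ ((dec y).getD (0, 0)).2) ⊆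
          f.1 (codedSet code ((dec y).getD (0, 0)).1)) (.imp (hv.comp .snd)
          ((hs.comp .snd).and ?_)) .id
      exact ComputablePred.comp (p := fun q : ℕ × ℕ => codedSet code q.1 ⊆ f.1 (codedSet code q.2))
        hf ((Primrec.two_pow.to_comp.comp (hX.comp .snd)).pair (hA.comp .snd))
    exact h.of_eq fun n => (codedSet_subset_lamSet_iff h₁ h₂ n f.1).symm

end GraphModel

end LambdaGraph

namespace LambdaGraph

/-! ### Coding trees by natural numbers -/

theorem setCode_injective : Function.Injective setCode := Finset.equivBitIndices.symm.injective

namespace RawTree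

variable {A : Type v} (κ : A ↪ ℕ)

/-- The code of a tree, given codes of the atoms. -/
def code : RawTree A → ℕ
  | atom a => 2 * κ a
  | node _ f x => 2 * Nat.pair (setCode (Finset.univ.image fun i => code (f i))) (code x) + 1

variable {κ}

/-- The code of a pair records the codes of its first component as a set, just as `Equiv` does, and
parity separates atoms from pairs. Codes therefore descend injectively to the quotient. -/
theorem equiv_iff_code_eq : ∀ {s t : RawTree A}, Equiv s t ↔ code κ s = code κ t
  | atom a, atom b => by simp [Equiv, code]
  | node _ f x, node _ g y => by
    simp only [Equiv, code, equiv_iff_code_eq, add_left_inj, mul_right_inj' two_ne_zero,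
      Nat.pair_eq_pair, setCode_injective.eq_iff, Finset.ext_iff, Finset.mem_image,
      Finset.mem_univ, true_and]
    constructor
    · rintro ⟨h₁, h₂, h₃⟩
      refine ⟨fun c => ⟨?_, ?_⟩, h₃⟩
      · rintro ⟨i, rfl⟩
        exact (h₁ i).imp fun _ h => h.symm
      · rintro ⟨j, rfl⟩
        exact h₂ j
    · rintro ⟨h, h₃⟩
      exact ⟨fun i => ((h _).1 ⟨i, rfl⟩).imp fun _ h => h.symm, fun j => (h _).2 ⟨j, rfl⟩, h₃⟩
  | atom _, node _ _ _ => by simp only [Equiv, code, false_iff]; omega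
  | node _ _ _, atom _ => by simp only [Equiv, code, false_iff]; omega

end RawTree

namespace HTree

variable {A : Type v} (κ : A ↪ ℕ)

/-- The code of a tree, given codes of the atoms. -/
def code : HTree A ↪ ℕ where
  toFun := Quotient.lift (RawTree.code κ) fun _ _ h => RawTree.equiv_iff_code_eq.1 h
  inj' := by
    intro s t
    induction s using Quotient.inductionOn
    induction t using Quotient.inductionOn
    exact fun h => Quotient.sound (RawTree.equiv_iff_code_eq.2 h)

theorem code_atom (a : A) : code κ (atom a) = 2 * κ a := rfl

theorem rawTree_code_out (t : HTree A) : RawTree.code κ t.out = code κ t := by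
  conv_rhs => rw [← Quotient.out_eq t]
  rfl

theorem code_pair (s : Finset (HTree A)) (x : HTree A) :
    code κ (pair s x) = 2 * Nat.pair (setCode (s.map (code κ))) (code κ x) + 1 := by
  have h : (Finset.univ.image fun i => RawTree.code κ (s.equivFin.symm i).1.out) =
      s.map (code κ) := by
    ext c
    simp only [rawTree_code_out, Finset.mem_image, Finset.mem_univ, true_and, Finset.mem_map]
    constructor
    · rintro ⟨i, rfl⟩
      exact ⟨_, (s.equivFin.symm i).2, rfl⟩
    · rintro ⟨t, ht, rfl⟩
      exact ⟨s.equivFin ⟨t, ht⟩, by rw [Equiv.symm_apply_apply]⟩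
  change RawTree.code κ (RawTree.node _ _ _) = _
  rw [RawTree.code, h, rawTree_code_out]

end HTree

namespace PartialPair

variable (A : PartialPair.{v})

/-- Replaces the levels of the completion by a case distinction: an element is an atom or was added
as a pair outside the domain of the partial function. -/
theorem completion_cases (t : A.Completion) : (∃ q, t.1 = HTree.atom q) ∨
    ∃ (s : Finset A.Completion) (x : A.Completion), t = A.completionFun s x ∧
      ¬ ∃ γ, A.atomGraph (s.map (Function.Embedding.subtype _)) x.1 γ := by
  classical
  obtain ⟨t, n, hn⟩ := t
  induction n with
  | zero =>
    obtain ⟨q, rfl⟩ := hn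
    exact .inl ⟨q, rfl⟩
  | succ n ih =>
    rcases hn with hn | ⟨s, x, rfl, hs, hx, h⟩
    · exact ih hn
    · have hs' : (s.subtype fun t => ∃ n, t ∈ A.level n).map (Function.Embedding.subtype _) = s :=
        Finset.subtype_map_of_mem fun t ht => ⟨n, hs ht⟩
      refine .inr ⟨s.subtype _, ⟨x, n, hx⟩, Subtype.ext ?_, by rwa [hs']⟩
      rw [A.completionFun_of_not_dom (by rwa [hs']), hs']

end PartialPair

/-! ### Codes for the completion of the disjoint union -/

namespace EffectiveEnumeration

variable (N : EffectiveEnumeration)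

/-- The codes of the elements of the disjoint union. -/
def unionCode : N.union.carrier ↪ ℕ where
  toFun q := Nat.pair (N.idx q) (N.val q)
  inj' q r h := by
    obtain ⟨h₁, h₂⟩ := Nat.pair_eq_pair.1 h
    exact union_ext h₁ h₂

/-- The elements of the completion as trees. -/
def toTree : N.model.carrier ↪ HTree N.union.carrier := Function.Embedding.subtype _

/-- The codes of the elements of the completion. -/
def code : N.model.carrier ↪ ℕ := N.toTree.trans (HTree.code N.unionCode)

/-- The codes of the atoms. -/
def atomCode : N.union.carrier ↪ ℕ := HTree.atom.trans (HTree.code N.unionCode)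

theorem atomCode_apply (q : N.union.carrier) :
    N.atomCode q = 2 * Nat.pair (N.idx q) (N.val q) := rfl

theorem code_atom (q : N.union.carrier) : N.code (N.atom q) = N.atomCode q := rfl

theorem atomGraph_iff (s : Finset N.model.carrier) (x : N.model.carrier) (γ : N.union.carrier) :
    N.union.atomGraph (s.map N.toTree) (N.toTree x) γ ↔
      ∃ a α, N.union.graph a α γ ∧ setCode (s.map N.code) = setCode (a.map N.atomCode) ∧
        N.code x = N.atomCode α := by
  refine exists_congr fun a => exists_congr fun α => and_congr_right fun _ => and_congr ?_ ?_
  · rw [setCode_injective.eq_iff, code, atomCode, ← Finset.map_map, ← Finset.map_map]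
    exact (Finset.map_injective _).eq_iff.symm
  · exact (HTree.code N.unionCode).injective.eq_iff.symm

theorem c_of_graph {s : Finset N.model.carrier} {x : N.model.carrier} {γ : N.union.carrier}
    (h : N.union.atomGraph (s.map N.toTree) (N.toTree x) γ) :
    N.model.c s x = N.atom γ :=
  Subtype.ext (N.union.completionFun_of_atomGraph h)

theorem code_c_of_not_dom {s : Finset N.model.carrier} {x : N.model.carrier}
    (h : ¬ ∃ γ, N.union.atomGraph (s.map N.toTree) (N.toTree x) γ) :
    N.code (N.model.c s x) = 2 * Nat.pair (setCode (s.map N.code)) (N.code x) + 1 := by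
  have h' := congrArg (HTree.code N.unionCode) (N.union.completionFun_of_not_dom h)
  rw [HTree.code_pair] at h'
  rw [code, ← Finset.map_map]
  exact h'

/-- The codes of the argument of an entry of the graph of the `k`-th finite partial pair. -/
def entryCode (k : ℕ) (e : (List ℕ × ℕ) × ℕ) : ℕ × ℕ :=
  (setCode (e.1.1.map fun j => 2 * Nat.pair k j).toFinset, 2 * Nat.pair k e.1.2)

theorem primrec_entryCode : Primrec₂ entryCode := by
  have h : Primrec₂ fun k j : ℕ => 2 * Nat.pair k j :=
    Primrec.nat_mul.comp (Primrec.const 2) Primrec₂.natPair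
  refine Primrec.pair (Primrec.setCode_toFinset.comp (Primrec.list_map
    (Primrec.fst.comp (Primrec.fst.comp Primrec.snd))
    (h.comp (Primrec.fst.comp Primrec.fst) Primrec.snd).to₂))
    (h.comp Primrec.fst (Primrec.snd.comp (Primrec.fst.comp Primrec.snd)))

variable {N} {g : ℕ → List ℕ × List ((List ℕ × ℕ) × ℕ)}
  (hg : ∀ k, (N.pair k).graph = ((g k).2.map fun q => ((q.1.1.toFinset, q.1.2), q.2)).toFinset)

include hg

/-- With `exists_graph`, this translates between entries of the computed lists and the graph of the
disjoint union. The lists may repeat elements, but the binary code depends only on the set. -/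
theorem exists_entry {a : Finset N.union.carrier} {α γ : N.union.carrier}
    (h : N.union.graph a α γ) : ∃ e ∈ (g (N.idx γ)).2, e.2 = N.val γ ∧
      entryCode (N.idx γ) e = (setCode (a.map N.atomCode), N.atomCode α) := by
  obtain ⟨hi, b, hb, hab⟩ := union_graph_iff.1 h
  have hbc := ((N.pair _).closed _ _ _ hb).1
  rw [hg, List.mem_toFinset, List.mem_map] at hb
  obtain ⟨e, he, heq⟩ := hb
  obtain ⟨⟨rfl, h₂⟩, h₃⟩ : (e.1.1.toFinset = b ∧ e.1.2 = N.val α) ∧ e.2 = N.val γ := by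
    simpa using heq
  rw [hi]
  refine ⟨e, he, h₃, ?_⟩
  have hset : (e.1.1.map fun j => 2 * Nat.pair (N.idx α) j).toFinset = a.map N.atomCode := by
    ext c
    simp only [List.mem_toFinset, List.mem_map, Finset.mem_map]
    constructor
    · rintro ⟨j, hj, rfl⟩
      obtain ⟨q, hq, rfl⟩ := exists_idx_val (hbc (List.mem_toFinset.2 hj))
      exact ⟨q, (hab q).2 ⟨hq, List.mem_toFinset.2 hj⟩, by rw [atomCode_apply, hq]⟩
    · rintro ⟨q, hq, rfl⟩
      obtain ⟨hq, hj⟩ := (hab q).1 hq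
      exact ⟨N.val q, List.mem_toFinset.1 hj, by rw [atomCode_apply, hq]⟩
  rw [entryCode, hset, h₂, atomCode_apply]

theorem exists_graph {k : ℕ} {e : (List ℕ × ℕ) × ℕ} (he : e ∈ (g k).2) :
    ∃ a α γ, N.union.graph a α γ ∧ N.idx γ = k ∧ N.val γ = e.2 ∧
      entryCode k e = (setCode (a.map N.atomCode), N.atomCode α) := by
  classical
  have hmem : ((e.1.1.toFinset, e.1.2), e.2) ∈ (N.pair k).graph := by
    rw [hg, List.mem_toFinset, List.mem_map]
    exact ⟨e, he, rfl⟩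
  obtain ⟨hb, hx, hy⟩ := (N.pair k).closed _ _ _ hmem
  obtain ⟨α, hα, hα'⟩ := exists_idx_val hx
  obtain ⟨γ, rfl, hγ'⟩ := exists_idx_val hy
  -- The copy of the argument set in the component of `γ`; it is finite because the underlying
  -- number is injective within a component.
  have hfin : {q | N.idx q = N.idx γ ∧ N.val q ∈ e.1.1.toFinset}.Finite := by
    refine Set.Finite.of_finite_image (f := N.val) ((Finset.finite_toSet e.1.1.toFinset).subset ?_)
      fun q hq r hr h => union_ext (hq.1.trans hr.1.symm) h
    rintro _ ⟨q, hq, rfl⟩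
    exact hq.2
  have hgr : N.union.graph hfin.toFinset α γ := by
    refine union_graph_iff.2 ⟨hα.symm, e.1.1.toFinset, by rwa [hα, hα', hγ'], fun q => ?_⟩
    rw [Set.Finite.mem_toFinset, hα]
    rfl
  obtain ⟨e', he', hv, hc⟩ := exists_entry hg hgr
  refine ⟨hfin.toFinset, α, γ, hgr, rfl, hγ', ?_⟩
  have hset : (e.1.1.map fun j => 2 * Nat.pair (N.idx γ) j).toFinset =
      hfin.toFinset.map N.atomCode := by
    ext c
    simp only [List.mem_toFinset, List.mem_map, Finset.mem_map, Set.Finite.mem_toFinset, Set.mem_ofPred_eq]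
    constructor
    · rintro ⟨j, hj, rfl⟩
      obtain ⟨q, hq, rfl⟩ := exists_idx_val (hb (List.mem_toFinset.2 hj))
      exact ⟨q, ⟨hq, hj⟩, by rw [atomCode_apply, hq]⟩
    · rintro ⟨q, ⟨hq, hj⟩, rfl⟩
      exact ⟨N.val q, hj, by rw [atomCode_apply, hq]⟩
  rw [entryCode, hset, atomCode_apply, hα, hα']

end EffectiveEnumeration

end LambdaGraph

/-! ### Decidability of the codes and computability of the inverse -/

namespace LambdaGraph

namespace EffectiveEnumeration

variable {N : EffectiveEnumeration} {g : ℕ → List ℕ × List ((List ℕ × ℕ) × ℕ)}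

/-- The numbers `s`, `x` code an argument of the function of the disjoint union, where `g`
enumerates the finite partial pairs. -/
def IsDom (g : ℕ → List ℕ × List ((List ℕ × ℕ) × ℕ)) (s x : ℕ) : Prop :=
  ∃ e ∈ (g (x / 2).unpair.1).2, entryCode (x / 2).unpair.1 e = (s, x)

/-- The code of an atom reveals its component, so only one list has to be searched. A number `x`
that codes no atom matches no entry. -/
theorem isDom_iff
    (hg : ∀ k, (N.pair k).graph = ((g k).2.map fun q => ((q.1.1.toFinset, q.1.2), q.2)).toFinset)
    (s x : ℕ) : IsDom g s x ↔ ∃ a α γ, N.union.graph a α γ ∧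
      s = setCode (a.map N.atomCode) ∧ x = N.atomCode α := by
  constructor
  · rintro ⟨e, he, h⟩
    obtain ⟨a, α, γ, hgr, -, -, hc⟩ := exists_graph hg he
    rw [h, Prod.mk.injEq] at hc
    exact ⟨a, α, γ, hgr, hc⟩
  · rintro ⟨a, α, γ, hgr, rfl, rfl⟩
    obtain ⟨e, he, -, hc⟩ := exists_entry hg hgr
    have hi : (N.atomCode α / 2).unpair.1 = N.idx γ := by
      rw [atomCode_apply, Nat.mul_div_cancel_left _ two_pos, Nat.unpair_pair,
        (union_graph_iff.1 hgr).1]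
    exact ⟨e, by rwa [hi], by rwa [hi]⟩

theorem isDom_code_iff
    (hg : ∀ k, (N.pair k).graph = ((g k).2.map fun q => ((q.1.1.toFinset, q.1.2), q.2)).toFinset)
    (s : Finset N.model.carrier) (x : N.model.carrier) :
    IsDom g (setCode (s.map N.code)) (N.code x) ↔
      ∃ γ, N.union.atomGraph (s.map N.toTree) (N.toTree x) γ := by
  rw [isDom_iff hg]
  simp only [atomGraph_iff]
  constructor
  · rintro ⟨a, α, γ, h⟩
    exact ⟨γ, a, α, h⟩
  · rintro ⟨γ, a, α, h⟩
    exact ⟨a, α, γ, h⟩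

theorem exists_setCode_eq {s : ℕ} (h : ∀ i, s.testBit i = true → i ∈ Set.range N.code) :
    ∃ a : Finset N.model.carrier, setCode (a.map N.code) = s := by
  obtain ⟨a, ha⟩ := (GraphModel.finite_codedSet (code := N.code) s).exists_finset_coe
  refine ⟨a, Nat.eq_of_testBit_eq fun i => Bool.eq_iff_iff.2 ?_⟩
  rw [testBit_setCode, Finset.mem_map]
  have ha' : ∀ e, e ∈ a ↔ s.testBit (N.code e) = true := fun e => by
    rw [← Finset.mem_coe, ha]; rfl
  constructor
  · rintro ⟨e, he, rfl⟩
    exact (ha' e).1 he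
  · intro hi
    obtain ⟨e, rfl⟩ := h i hi
    exact ⟨e, (ha' e).2 hi, rfl⟩

theorem model_cases (t : N.model.carrier) : (∃ q, t = N.atom q) ∨
    ∃ (s : Finset N.model.carrier) (x : N.model.carrier), t = N.model.c s x ∧
      ¬ ∃ γ, N.union.atomGraph (s.map N.toTree) (N.toTree x) γ := by
  rcases N.union.completion_cases t with ⟨q, hq⟩ | h
  · exact .inl ⟨q, Subtype.ext hq⟩
  · exact .inr h

/-- The recursion for the set of codes: even codes belong to atoms, odd ones to pairs of already
valid codes outside the domain of the partial function. -/
theorem mem_range_code_iff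
    (hg : ∀ k, (N.pair k).graph = ((g k).2.map fun q => ((q.1.1.toFinset, q.1.2), q.2)).toFinset)
    (n : ℕ) : n ∈ Set.range N.code ↔
      (n % 2 = 0 ∧ (n / 2).unpair.2 ∈ (N.pair (n / 2).unpair.1).carrier) ∨
      (n % 2 = 1 ∧ (∀ i, (n / 2).unpair.1.testBit i = true → i ∈ Set.range N.code) ∧
        (n / 2).unpair.2 ∈ Set.range N.code ∧ ¬ IsDom g (n / 2).unpair.1 (n / 2).unpair.2) := by
  constructor
  · rintro ⟨t, rfl⟩
    rcases model_cases t with ⟨q, rfl⟩ | ⟨s, x, rfl, h⟩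
    · refine .inl ?_
      rw [code_atom, atomCode_apply, Nat.mul_div_cancel_left _ two_pos, Nat.unpair_pair]
      exact ⟨by omega, val_mem q⟩
    · refine .inr ?_
      rw [code_c_of_not_dom N h]
      have hdiv : ∀ m, (2 * m + 1) / 2 = m := fun m => by omega
      rw [hdiv, Nat.unpair_pair]
      refine ⟨by omega, fun i hi => ?_, ⟨x, rfl⟩, (isDom_code_iff hg s x).not.2 h⟩
      obtain ⟨t, -, rfl⟩ := Finset.mem_map.1 (testBit_setCode.1 hi)
      exact ⟨t, rfl⟩
  · rintro (⟨h₀, h⟩ | ⟨h₁, hs, ⟨x, hx⟩, h⟩)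
    · obtain ⟨q, hq₁, hq₂⟩ := exists_idx_val h
      refine ⟨N.atom q, ?_⟩
      rw [code_atom, atomCode_apply, hq₁, hq₂, Nat.pair_unpair]
      omega
    · obtain ⟨s, hs⟩ := exists_setCode_eq hs
      rw [← hs, ← hx, isDom_code_iff hg] at h
      refine ⟨N.model.c s x, ?_⟩
      rw [code_c_of_not_dom N h, hs, hx, Nat.pair_unpair]
      omega

theorem computablePred_isDom (hgc : Computable g) {α : Type*} [Primcodable α] {f h : α → ℕ}
    (hf : Computable f) (hh : Computable h) : ComputablePred fun a => IsDom g (f a) (h a) := by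
  have hk : Computable fun x : ℕ => (x / 2).unpair.1 :=
    Computable.fst.comp (Computable.unpair.comp
      (Primrec.nat_div.comp Primrec.id (Primrec.const 2)).to_comp)
  refine .comp (p := fun q : ℕ × ℕ => IsDom g q.1 q.2) ?_ (hf.pair hh)
  refine .exists_mem_list (p := fun (q : ℕ × ℕ) e => entryCode (q.2 / 2).unpair.1 e = (q.1, q.2))
    (.eq (primrec_entryCode.to_comp.comp (hk.comp (Computable.snd.comp .fst)) .snd) .fst)
    (Computable.snd.comp (hgc.comp (hk.comp .snd)))

theorem computablePred_range_code (hgc : Computable g)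
    (hgcar : ∀ k, (N.pair k).carrier = (g k).1.toFinset)
    (hg : ∀ k, (N.pair k).graph = ((g k).2.map fun q => ((q.1.1.toFinset, q.1.2), q.2)).toFinset) :
    ComputablePred fun n => n ∈ Set.range N.code := by
  have hdiv : Computable fun q : ℕ × ℕ => q.1 / 2 :=
    (Primrec.nat_div.comp Primrec.fst (Primrec.const 2)).to_comp
  have hu₁ : Computable fun q : ℕ × ℕ => (q.1 / 2).unpair.1 :=
    Computable.fst.comp (Computable.unpair.comp hdiv)
  have hu₂ : Computable fun q : ℕ × ℕ => (q.1 / 2).unpair.2 :=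
    Computable.snd.comp (Computable.unpair.comp hdiv)
  have hmod : Computable fun q : ℕ × ℕ => q.1 % 2 :=
    (Primrec.nat_mod.comp Primrec.fst (Primrec.const 2)).to_comp
  have hcar : ComputablePred fun q : ℕ × ℕ =>
      ∃ j ∈ (g (q.1 / 2).unpair.1).1, j = (q.1 / 2).unpair.2 :=
    .exists_mem_list (p := fun (q : ℕ × ℕ) j => j = (q.1 / 2).unpair.2)
      (.eq .snd (hu₂.comp .fst)) (Computable.fst.comp (hgc.comp hu₁))
  have hsub : ComputablePred fun q : ℕ × ℕ => ∀ i, (q.1 / 2).unpair.1.testBit i = true →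
      q.2.testBit i = true :=
    .forall_testBit (p := fun (q : ℕ × ℕ) i => q.2.testBit i = true)
      (.testBit (Computable.snd.comp .fst) .snd) hu₁
  refine .of_strong_rec (((ComputablePred.eq hmod (Computable.const 0)).and hcar).or
    ((ComputablePred.eq hmod (Computable.const 1)).and (hsub.and
      ((ComputablePred.testBit .snd hu₂).and (computablePred_isDom hgc hu₁ hu₂).not)))) fun n => ?_
  rw [mem_range_code_iff hg]
  refine or_congr (and_congr_right fun _ => ?_) (and_congr_right fun hn => ?_)
  · simp [hgcar]
  -- Since `n` is odd it is positive, so `n / 2 < n`, and all codes that the recursion asks about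
  -- are among the smaller numbers already decided.
  · have hlt : ∀ i, i ≤ n / 2 → i < n := fun i hi => by omega
    simp only [testBit_setCode, Finset.mem_filter, Finset.mem_range]
    refine and_congr (forall_congr' fun i => imp_congr_right fun hi => ?_) (and_congr ?_ Iff.rfl)
    · have hi' : i < n := hlt i ((lt_of_testBit hi).le.trans (Nat.unpair_left_le _))
      simp [hi']
    · have hi' : (n / 2).unpair.2 < n := hlt _ (Nat.unpair_right_le _)
      simp [hi']

/-- The inverse of the function of the completion on codes. -/
def decode (g : ℕ → List ℕ × List ((List ℕ × ℕ) × ℕ)) (n : ℕ) : Option (ℕ × ℕ) :=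
  if n % 2 = 1 then some (n / 2).unpair
  else ((g (n / 2).unpair.1).2.filter fun e => e.2 = (n / 2).unpair.2).head?.map
    (entryCode (n / 2).unpair.1)

theorem computable_decode (hgc : Computable g) : Computable (decode g) := by
  have hdiv : Computable fun n : ℕ => (n / 2).unpair :=
    Computable.unpair.comp (Primrec.nat_div.comp Primrec.id (Primrec.const 2)).to_comp
  have hmod : Computable fun n : ℕ => n % 2 :=
    (Primrec.nat_mod.comp Primrec.id (Primrec.const 2)).to_comp
  have hfilter : Primrec₂ fun (l : List ((List ℕ × ℕ) × ℕ)) (i : ℕ) =>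
      l.filter fun e => e.2 = i :=
    PrimrecRel.listFilter (R := fun (e : (List ℕ × ℕ) × ℕ) (i : ℕ) => e.2 = i)
      (Primrec.eq.comp (Primrec.snd.comp Primrec.fst) Primrec.snd)
  have hhead : Computable fun n : ℕ =>
      ((g (n / 2).unpair.1).2.filter fun e => e.2 = (n / 2).unpair.2).head? :=
    Primrec.list_head?.to_comp.comp (hfilter.to_comp.comp
      (Computable.snd.comp (hgc.comp (Computable.fst.comp hdiv))) (Computable.snd.comp hdiv))
  have hentry : Computable₂ fun (n : ℕ) (e : (List ℕ × ℕ) × ℕ) => entryCode (n / 2).unpair.1 e :=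
    primrec_entryCode.to_comp.comp (Computable.fst.comp (hdiv.comp .fst)) .snd
  exact (ComputablePred.eq hmod (Computable.const 1)).if_then_else
    (Computable.option_some.comp hdiv) (Computable.option_map hhead hentry)

theorem decode_two_mul_add_one (s x : ℕ) : decode g (2 * Nat.pair s x + 1) = some (s, x) := by
  have h₁ : (2 * Nat.pair s x + 1) % 2 = 1 := by omega
  have h₂ : (2 * Nat.pair s x + 1) / 2 = Nat.pair s x := by omega
  rw [decode, if_pos h₁, h₂, Nat.unpair_pair]

theorem decode_atomCode (q : N.union.carrier) : decode g (N.atomCode q) =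
    ((g (N.idx q)).2.filter fun e => e.2 = N.val q).head?.map (entryCode (N.idx q)) := by
  have h₁ : ¬ (2 * Nat.pair (N.idx q) (N.val q)) % 2 = 1 := by omega
  have h₂ : 2 * Nat.pair (N.idx q) (N.val q) / 2 = Nat.pair (N.idx q) (N.val q) := by omega
  rw [atomCode_apply, decode, if_neg h₁, h₂, Nat.unpair_pair]

section

variable
  (hg : ∀ k, (N.pair k).graph = ((g k).2.map fun q => ((q.1.1.toFinset, q.1.2), q.2)).toFinset)

include hg

theorem exists_graph_of_decode {γ : N.union.carrier} {r : ℕ × ℕ}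
    (h : decode g (N.atomCode γ) = some r) : ∃ a α, N.union.graph a α γ ∧
      r = (setCode (a.map N.atomCode), N.atomCode α) := by
  rw [decode_atomCode, Option.map_eq_some_iff] at h
  obtain ⟨e, he, rfl⟩ := h
  have he' := List.mem_of_head? he
  rw [List.mem_filter, decide_eq_true_iff] at he'
  obtain ⟨a, α, γ', hgr, hi, hv, hc⟩ := exists_graph hg he'.1
  obtain rfl := union_ext hi (hv.trans he'.2)
  exact ⟨a, α, hgr, hc⟩

theorem decode_code_c (s : Finset N.model.carrier) (x : N.model.carrier) :
    decode g (N.code (N.model.c s x)) = some (setCode (s.map N.code), N.code x) := by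
  by_cases h : ∃ γ, N.union.atomGraph (s.map N.toTree) (N.toTree x) γ
  · obtain ⟨γ, hγ⟩ := h
    rw [c_of_graph N hγ, code_atom]
    obtain ⟨a, α, hgr, hs, hx⟩ := (atomGraph_iff N s x γ).1 hγ
    rw [hs, hx]
    obtain ⟨e, he, hv, hc⟩ := exists_entry hg hgr
    obtain ⟨r, hr⟩ : ∃ r, decode g (N.atomCode γ) = some r := by
      rw [← Option.isSome_iff_exists, decode_atomCode, Option.isSome_map, List.isSome_head?]
      exact List.ne_nil_of_mem (List.mem_filter.2 ⟨he, decide_eq_true hv⟩)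
    -- The first entry found with value `γ` need not be the given one, but injectivity of the
    -- partial function forces the same argument.
    obtain ⟨a', α', hgr', rfl⟩ := exists_graph_of_decode hg hr
    obtain ⟨rfl, rfl⟩ := N.union.inj _ _ _ _ _ hgr hgr'
    exact hr
  · rw [code_c_of_not_dom N h, decode_two_mul_add_one]

/-- A decoded atom would be the value of an entry of the partial function, hence a value of `c`;
elements formed as pairs are values of `c` anyway. -/
theorem decode_eq_none (t : N.model.carrier) (ht : ∀ s x, t ≠ N.model.c s x) :
    decode g (N.code t) = none := by
  rcases model_cases t with ⟨q, rfl⟩ | ⟨s, x, rfl, -⟩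
  · rw [code_atom, Option.eq_none_iff_forall_ne_some]
    intro r hr
    obtain ⟨a, α, hgr, -⟩ := exists_graph_of_decode hg hr
    exact ht (a.map ⟨N.atom, fun q r h => HTree.atom.injective (Subtype.ext_iff.1 h)⟩) (N.atom α)
      (c_eq_atom hgr (Finset.coe_map _ _)).symm
  · exact absurd rfl (ht s x)

end

theorem isEffective_model (N : EffectiveEnumeration) : N.model.IsEffective := by
  obtain ⟨g, hgc, hg⟩ := N.computable
  exact GraphModel.isEffective_of_code
    (computablePred_range_code hgc (fun k => (hg k).1) fun k => (hg k).2) (computable_decode hgc)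
    (decode_code_c fun k => (hg k).2) (decode_eq_none fun k => (hg k).2)

end EffectiveEnumeration

end LambdaGraph

theorem mainTheorem4 :
    (∃ N : LambdaGraph.EffectiveEnumeration, Function.Bijective N.pair) ∧
    ∀ N : LambdaGraph.EffectiveEnumeration,
      N.model.IsEffective ∧
      IsLeast LambdaGraph.orderGraphTheories.{u} N.model.ordTheory ∧
      IsLeast LambdaGraph.eqGraphTheories.{u} N.model.eqTheory :=
  ⟨LambdaGraph.exists_bijective_effectiveEnumeration, fun N =>
    ⟨N.isEffective_model, N.isLeast_ordTheory, N.isLeast_eqTheory⟩⟩
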